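/- **Setting.** Let $T>0$, let $(W_t)_{t\in[0,T]}$ be a one-dimensional Wiener process on a filtered probability space $(\Omega,\mathcal F,(\mathcal F_t)_{t\in[0,T]},\mathbb Q)$, let $r,\mu\in\mathbb R$ with $\mu\neq r$, let $\sigma>0$, and put $\gamma=\sigma^{-1}(\mu-r)$ and $\tilde Z_T=\exp\!\big(-(r+\tfrac12\gamma^2)T-\gamma W_T\big)$ (the Black–Scholes state price density). Let $v_0>0$, $b>0$ with $b\ne 1$, and $a\in\mathbb R$. Let $\mathcal P$ be the set of fee structures $(m,\alpha,c)\in[0,1]\times(0,1]\times[0,1]$ with $c<1+m$ and with $a\ge v_0(c-m)$ if $b<1$, $a>v_0(c-m)$ if $b>1$. For $(m,\alpha,c)\in\mathcal P$ the manager's payoff and HARA utility, as functions of the fund's terminal value $v\ge 0$, are $$M(v)=\begin{cases} v_0(m-c), & v-mv_0<(1-c)v_0,\\ v-v_0, & (1-c)v_0\le v-mv_0<v_0,\\ mv_0+\alpha(v-(1+m)v_0), & v-mv_0\ge v_0,\end{cases}\qquad U_M(v)=\frac{(M(v)+a)^{1-b}}{1-b},$$ and $U_M(v)=-\infty$ for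 $v<0$. An *optimal terminal value* is a maximiser of $\mathbb E[U_M(V)]$ over all $\mathcal F_T$-measurable $V$ with $V\ge0$ a.s. and $\mathbb E[\tilde Z_TV]\le v_0$. A *concavification point* of $U_M$ is a number $\theta\ge(1+m-c)v_0$ such that, with $s(\theta)=(U_M(\theta)-U_M(0))/\theta$, the function equal to $-\infty$ on $(-\infty,0)$, to $U_M(0)+s(\theta)v$ on $[0,\theta)$ and to $U_M(v)$ on $[\theta,\infty)$ is the concave envelope of $U_M$, i.e. the smallest concave function $\mathbb R\to\mathbb R\cup\{-\infty\}$ that dominates $U_M$. Put $$H=\frac{(mv_0+a)^{1-b}-(v_0(m-c)+a)^{1-b}}{(1-b)(1+m)v_0},$$ and, with the convention $0^{-b}=+\infty$, $$\mathcal P_A=\{H<\alpha(mv_0+a)^{-b}\},\quad \mathcal P_B=\{\alpha(mv_0+a)^{-b}\le H\le(mv_0+a)^{-b}\},\quad \mathcal P_C=\{(mv_0+a)^{-b}<H\},$$ understood as subsets of $\mathcal P$. For $y,z>0$ let $I_3(yz)=\alpha^{1/b-1}(yz)^{-1/b}+(1+m-\alpha^{-1}m)v_0-\alpha^{-1}a$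 and $I_2(yz)=(yz)^{-1/b}+v_0-a$. **Statement.** The sets $\mathcal P_A,\mathcal P_B,\mathcal P_C$ are pairwise disjoint with union $\mathcal P$. For each $(m,\alpha,c)\in\mathcal P$, $U_M$ has exactly one concavification point $\theta_1$, and with $s=s(\theta_1)$ the following holds. *Case A*, $(m,\alpha,c)\in\mathcal P_A$: $\theta_1$ is the unique solution on $((1+m)v_0,\infty)$ of $$(\alpha v+(m-\alpha(1+m))v_0+a)^{-b}\,(b\alpha v+(m-\alpha(1+m))v_0+a)=(v_0(m-c)+a)^{1-b},$$ $s=\alpha(\alpha\theta_1+(m-\alpha(1+m))v_0+a)^{-b}$, and $$v^*(y,z)=I_3(yz)\,\mathbf 1_{(0,\,s/y]}(z).$$ *Case B*, $(m,\alpha,c)\in\mathcal P_B$: $\theta_1=(1+m)v_0$, $s=H$, and $$v^*(y,z)=I_3(yz)\,\mathbf 1_{(0,\,\alpha(mv_0+a)^{-b}/y)}(z)+(1+m)v_0\,\mathbf 1_{[\alpha(mv_0+a)^{-b}/y,\ s/y]}(z).$$ *Case C*, $(m,\alpha,c)\in\mathcal P_C$: $\theta_1$ is the unique solution on $((1+m-c)v_0,(1+m)v_0)$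 of $$(v-v_0+a)^{-b}(bv-v_0+a)=(v_0(m-c)+a)^{1-b},$$ $s=(\theta_1-v_0+a)^{-b}$, and $$v^*(y,z)=I_3(yz)\,\mathbf 1_{(0,\,\alpha(mv_0+a)^{-b}/y)}(z)+(1+m)v_0\,\mathbf 1_{[\alpha(mv_0+a)^{-b}/y,\ (mv_0+a)^{-b}/y]}(z)+I_2(yz)\,\mathbf 1_{((mv_0+a)^{-b}/y,\ s/y]}(z).$$ In all three cases $\mathbb E[\tilde Z_T v^*(y,\tilde Z_T)]$ is finite for every $y>0$, there is a unique $y^*>0$ with $\mathbb E[\tilde Z_T v^*(y^*,\tilde Z_T)]=v_0$, every $V$ admitted in the maximisation problem has finite expected utility, and $V_T^*=v^*(y^*,\tilde Z_T)$ is the $\mathbb Q$-a.s. unique optimal terminal value. -/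

import Mathlib

open MeasureTheory ProbabilityTheory
open scoped ENNReal

noncomputable section

namespace FirstLoss

/-! ### Market -/

/-- A one-dimensional Wiener process on `[0, T]` with respect to a filtration `ℱ`. -/
structure IsWienerProcess {Ω : Type*} {mΩ : MeasurableSpace Ω} {T : ℝ}
    (W : Set.Icc (0 : ℝ) T → Ω → ℝ) (ℱ : Filtration (Set.Icc (0 : ℝ) T) mΩ)
    (Q : Measure Ω) : Prop where
  adapted : ∀ t, Measurable[ℱ t] (W t)
  start_zero : ∀ t : Set.Icc (0 : ℝ) T, (t : ℝ) = 0 → ∀ᵐ ω ∂Q, W t ω = 0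
  gaussian_increments : ∀ s t : Set.Icc (0 : ℝ) T, s ≤ t →
    Q.map (fun ω => W t ω - W s ω) = gaussianReal 0 (Real.toNNReal ((t : ℝ) - (s : ℝ)))
  indep_increments : ∀ s t : Set.Icc (0 : ℝ) T, s ≤ t →
    Indep (MeasurableSpace.comap (fun ω => W t ω - W s ω) inferInstance) (ℱ s) Q
  continuous_paths : ∀ᵐ ω ∂Q, Continuous (fun t => W t ω)

/-- The terminal time `T` as a point of `[0, T]`. -/
def terminal {T : ℝ} (hT : 0 < T) : Set.Icc (0 : ℝ) T := ⟨T, hT.le, le_rfl⟩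

/-- The state price density `Z̃_t = exp (-(r + γ² / 2) t - γ W_t)` of the Black-Scholes market,
where `γ = σ⁻¹ (μ - r)` is the market price of risk. -/
def statePriceDensity {Ω : Type*} {T : ℝ} (r μ σ : ℝ)
    (W : Set.Icc (0 : ℝ) T → Ω → ℝ) (t : Set.Icc (0 : ℝ) T) (ω : Ω) : ℝ :=
  Real.exp (-(r + (1 / 2) * (σ⁻¹ * (μ - r)) ^ 2) * (t : ℝ) - (σ⁻¹ * (μ - r)) * W t ω)

/-! ### Fees, payoff and HARA utility -/

/-- A first-loss fee structure: management fee `m`, performance fee `α`,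
first-loss coverage guarantee `c`. -/
structure FeeStructure where
  m : ℝ
  α : ℝ
  c : ℝ

/-- The fee structures under consideration, for initial capital `v₀` and HARA parameters
`a = a_M`, `b = b_M`. The condition `c < 1 + m` says that the level
`(1 + m - c) v₀` below which the manager's payoff is flat is positive. -/
def admissibleFees (v₀ a b : ℝ) : Set FeeStructure :=
  {p | p.m ∈ Set.Icc (0 : ℝ) 1 ∧ p.α ∈ Set.Ioc (0 : ℝ) 1 ∧ p.c ∈ Set.Icc (0 : ℝ) 1 ∧
    p.c < 1 + p.m ∧
    (b < 1 → v₀ * (p.c - p.m) ≤ a) ∧ (1 < b → v₀ * (p.c - p.m) < a)}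

/-- The manager's terminal payoff as a function of the fund's terminal value `v`. -/
def managerPayoff (v₀ : ℝ) (p : FeeStructure) (v : ℝ) : ℝ :=
  if v - p.m * v₀ < (1 - p.c) * v₀ then v₀ * (p.m - p.c)
  else if v - p.m * v₀ < v₀ then v - v₀
  else p.m * v₀ + p.α * (v - (1 + p.m) * v₀)

/-- HARA utility. -/
def hara (a b x : ℝ) : ℝ := (1 / (1 - b)) * (x + a) ^ (1 - b)

/-- The manager's utility `U_M` as a function of the fund's terminal value `v ≥ 0`. -/
def managerUtility (v₀ a b : ℝ) (p : FeeStructure) (v : ℝ) : ℝ :=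
  hara a b (managerPayoff v₀ p v)

/-! ### Concave envelope and concavification point -/

/-- A function `U` on `[0, ∞)` extended by `-∞` to the negative half-line. -/
def extendBot (U : ℝ → ℝ) (v : ℝ) : EReal := if v < 0 then ⊥ else ((U v : ℝ) : EReal)

/-- Concavity of a function with values in `ℝ ∪ {-∞}`: its hypograph is convex. -/
def IsConcaveExt (g : ℝ → EReal) : Prop :=
  (∀ v, g v ≠ ⊤) ∧ Convex ℝ {q : ℝ × ℝ | (q.2 : EReal) ≤ g q.1}

/-- `u` is the smallest concave function `ℝ → ℝ ∪ {-∞}` that dominates `f`. -/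
def IsConcaveEnvelope (u f : ℝ → EReal) : Prop :=
  IsConcaveExt u ∧ (∀ v, f v ≤ u v) ∧
    ∀ g : ℝ → EReal, IsConcaveExt g → (∀ v, f v ≤ g v) → ∀ v, u v ≤ g v

/-- The slope `s(θ)` of the chord of `U` from `0` to `θ`. -/
def chordSlope (U : ℝ → ℝ) (θ : ℝ) : ℝ := (U θ - U 0) / θ

/-- The function equal to `-∞` on `(-∞, 0)`, to the chord of `U` on `[0, θ)`, and to `U` on
`[θ, ∞)`. -/
def chordThen (U : ℝ → ℝ) (θ : ℝ) (v : ℝ) : EReal :=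
  if v < 0 then ⊥
  else if v < θ then ((U 0 + chordSlope U θ * v : ℝ) : EReal)
  else ((U v : ℝ) : EReal)

/-- `θ ≥ (1 + m - c) v₀` is a concavification point of `U_M`: replacing `U_M` on `[0, θ)` by its
chord gives the concave envelope of `U_M`. -/
def IsConcavificationPoint (v₀ a b : ℝ) (p : FeeStructure) (θ : ℝ) : Prop :=
  (1 + p.m - p.c) * v₀ ≤ θ ∧
    IsConcaveEnvelope (chordThen (managerUtility v₀ a b p) θ)
      (extendBot (managerUtility v₀ a b p))

/-! ### The three regions -/

/-- The threshold quantity `H`. -/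
def thresholdH (v₀ a b : ℝ) (p : FeeStructure) : ℝ :=
  ((p.m * v₀ + a) ^ (1 - b) - (v₀ * (p.m - p.c) + a) ^ (1 - b)) /
    ((1 - b) * (1 + p.m) * v₀)

/-- The marginal utility `(m v₀ + a)^(-b)`, with values in `[0, ∞]` so that `0^(-b) = ∞`. -/
def kinkMarginal (v₀ a b : ℝ) (p : FeeStructure) : EReal :=
  ((ENNReal.ofReal (p.m * v₀ + a) ^ (-b) : ℝ≥0∞) : EReal)

/-- Region `P_A`. -/
def regionA (v₀ a b : ℝ) : Set FeeStructure :=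
  {p | p ∈ admissibleFees v₀ a b ∧
    (thresholdH v₀ a b p : EReal) < (p.α : EReal) * kinkMarginal v₀ a b p}

/-- Region `P_B`. -/
def regionB (v₀ a b : ℝ) : Set FeeStructure :=
  {p | p ∈ admissibleFees v₀ a b ∧
    (p.α : EReal) * kinkMarginal v₀ a b p ≤ (thresholdH v₀ a b p : EReal) ∧
    (thresholdH v₀ a b p : EReal) ≤ kinkMarginal v₀ a b p}

/-- Region `P_C`. -/
def regionC (v₀ a b : ℝ) : Set FeeStructure :=
  {p | p ∈ admissibleFees v₀ a b ∧
    kinkMarginal v₀ a b p < (thresholdH v₀ a b p : EReal)}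

/-! ### Equations for the concavification points and explicit terminal values -/

/-- The equation for `θ₁` in Case A. -/
def EquationA (v₀ a b : ℝ) (p : FeeStructure) (v : ℝ) : Prop :=
  (p.α * v + (p.m - p.α * (1 + p.m)) * v₀ + a) ^ (-b) *
      (b * p.α * v + (p.m - p.α * (1 + p.m)) * v₀ + a)
    = (v₀ * (p.m - p.c) + a) ^ (1 - b)

/-- The equation for `θ₁` in Case C. -/
def EquationC (v₀ a b : ℝ) (p : FeeStructure) (v : ℝ) : Prop :=
  (v - v₀ + a) ^ (-b) * (b * v - v₀ + a) = (v₀ * (p.m - p.c) + a) ^ (1 - b)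

/-- `α^(1/b - 1) (y z)^(-1/b) + (1 + m - α⁻¹ m) v₀ - α⁻¹ a`. -/
def upperPiece (v₀ a b : ℝ) (p : FeeStructure) (y z : ℝ) : ℝ :=
  p.α ^ (1 / b - 1) * (y * z) ^ (-1 / b) + (1 + p.m - p.α⁻¹ * p.m) * v₀ - p.α⁻¹ * a

/-- `(y z)^(-1/b) + v₀ - a`. -/
def middlePiece (v₀ a b y z : ℝ) : ℝ := (y * z) ^ (-1 / b) + v₀ - a

/-- The terminal value in Case A at multiplier `y` and state price `z`, for slope `s`. -/
def valueA (v₀ a b : ℝ) (p : FeeStructure) (s y z : ℝ) : ℝ :=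
  (Set.Ioc 0 (s / y)).indicator (upperPiece v₀ a b p y) z

/-- The terminal value in Case B. -/
def valueB (v₀ a b : ℝ) (p : FeeStructure) (s y z : ℝ) : ℝ :=
  (Set.Ioo 0 (p.α * (p.m * v₀ + a) ^ (-b) / y)).indicator (upperPiece v₀ a b p y) z +
    (Set.Icc (p.α * (p.m * v₀ + a) ^ (-b) / y) (s / y)).indicator
      (fun _ => (1 + p.m) * v₀) z

/-- The terminal value in Case C. -/
def valueC (v₀ a b : ℝ) (p : FeeStructure) (s y z : ℝ) : ℝ :=
  (Set.Ioo 0 (p.α * (p.m * v₀ + a) ^ (-b) / y)).indicator (upperPiece v₀ a b p y) z +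
    (Set.Icc (p.α * (p.m * v₀ + a) ^ (-b) / y) ((p.m * v₀ + a) ^ (-b) / y)).indicator
      (fun _ => (1 + p.m) * v₀) z +
    (Set.Ioc ((p.m * v₀ + a) ^ (-b) / y) (s / y)).indicator (middlePiece v₀ a b y) z

/-! ### The manager's problem -/

/-- `V` is feasible: it is `mT`-measurable, nonnegative, and `E[Z V] ≤ v₀`. -/
def IsFeasible {Ω : Type*} {mΩ : MeasurableSpace Ω} (Q : Measure Ω) (mT : MeasurableSpace Ω)
    (Z : Ω → ℝ) (v₀ : ℝ) (V : Ω → ℝ) : Prop :=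
  Measurable[mT] V ∧ (∀ᵐ ω ∂Q, 0 ≤ V ω) ∧
    Integrable (fun ω => Z ω * V ω) Q ∧ ∫ ω, Z ω * V ω ∂Q ≤ v₀

/-- `V` maximises the expected utility `E[U(V)]` over all feasible terminal values; in particular
all these expectations exist and are finite. -/
def IsOptimal {Ω : Type*} {mΩ : MeasurableSpace Ω} (Q : Measure Ω) (mT : MeasurableSpace Ω)
    (Z : Ω → ℝ) (v₀ : ℝ) (U : ℝ → ℝ) (V : Ω → ℝ) : Prop :=
  IsFeasible Q mT Z v₀ V ∧ Integrable (fun ω => U (V ω)) Q ∧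
    ∀ V' : Ω → ℝ, IsFeasible Q mT Z v₀ V' →
      Integrable (fun ω => U (V' ω)) Q ∧ ∫ ω, U (V' ω) ∂Q ≤ ∫ ω, U (V ω) ∂Q

/-- There is a unique `y > 0` with `E[Z v(y, Z)] = v₀` (all these expectations being finite), and
for this `y` the random variable `v(y, Z)` is the almost surely unique optimal terminal value. -/
def IsSolvedBy {Ω : Type*} {mΩ : MeasurableSpace Ω} (Q : Measure Ω) (mT : MeasurableSpace Ω)
    (Z : Ω → ℝ) (v₀ : ℝ) (U : ℝ → ℝ) (v : ℝ → ℝ → ℝ) : Prop :=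
  (∀ y : ℝ, 0 < y → Integrable (fun ω => Z ω * v y (Z ω)) Q) ∧
  ∃ y : ℝ, 0 < y ∧ ∫ ω, Z ω * v y (Z ω) ∂Q = v₀ ∧
    (∀ y' : ℝ, 0 < y' → ∫ ω, Z ω * v y' (Z ω) ∂Q = v₀ → y' = y) ∧
    IsOptimal Q mT Z v₀ U (fun ω => v y (Z ω)) ∧
    ∀ V : Ω → ℝ, IsOptimal Q mT Z v₀ U V → V =ᵐ[Q] fun ω => v y (Z ω)

end FirstLoss

end

/-! Pricing the budget with a multiplier y reduces the problem to maximising U(v) - q v over v ≥ 0,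
separately for each price q = y z. Beyond its flat part the payoff is piecewise linear with slope 1
and then α ≤ 1, hence concave and strictly increasing; composed with strictly concave power utility
it leaves a unique maximiser there, `demand`. Its regimes are: above the kink K = (1+m)v₀, at the
kink, and below it. The flat part makes v = 0 a competitor. If a line of slope s > 0 from (0, U(0))
supports U with contact point θ, then `demand` wins for q < s and 0 wins for q > s; this is
`optimalValue`. `IsTangentPoint` encodes the contact, and from it follow the concave envelope
(`IsTangentPoint.isConcavificationPoint_iff`) and strict pointwise optimality
(`IsTangentPoint.lt_optimalValue`).

The three cases only locate the contact point. H is the slope of the chord from 0 to K, and with k =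
m v₀ + a the two linear branches have marginal utilities k^(-b) and α k^(-b) at K. If H lies between
them, the chord to the kink already supports U; if H is smaller, the contact is a tangency beyond K;
if H is larger, a tangency before K. Tangencies come from the intermediate value theorem
(`exists_tangent`) and are unique by strict concavity (`tangent_unique`).

The state price is the exponential of a nondegenerate Gaussian. All its powers are integrable, so
costs are finite; it has no atoms, so the jump at q = s does not break continuity of the cost in y;
it is arbitrarily small with positive probability, so the cost is strictly decreasing and unbounded
near y = 0. This gives y*, and integrating the pointwise inequality gives optimality and uniqueness
(`IsTangentPoint.isSolvedBy`). -/

namespace FirstLoss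

open Filter Topology

/-! ### Power utility and its conjugate equation -/

/-- The strict tangent inequality for power utility. -/
theorem power_lt_tangent {b x y : ℝ} (hb : 0 < b) (hb1 : b ≠ 1) (hy : 0 < y) (hx : 0 ≤ x)
    (hx' : 1 < b → 0 < x) (hxy : x ≠ y) :
    1 / (1 - b) * x ^ (1 - b) < 1 / (1 - b) * y ^ (1 - b) + y ^ (-b) * (x - y) := by
  obtain ⟨t, ht, ht'⟩ : ∃ t : ℝ, 0 ≤ t ∧ x = y * t := ⟨x / y, by positivity, by field_simp⟩
  have ht1 : t ≠ 1 := by rintro rfl; exact hxy (by simpa using ht')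
  -- By homogeneity it suffices to treat the tangent at 1: Bernoulli's inequality for b < 1, and exp
  -- u ≥ 1 + u with log t < t - 1 for b > 1.
  have key : 1 / (1 - b) * t ^ (1 - b) < 1 / (1 - b) + (t - 1) := by
    rcases lt_or_gt_of_ne hb1 with h | h
    · have h0 : 0 < 1 - b := by linarith
      have := rpow_one_add_lt_one_add_mul_self (s := t - 1) (by linarith)
        (sub_ne_zero.2 ht1) h0 (by linarith)
      rw [add_sub_cancel] at this
      rw [one_div, inv_mul_lt_iff₀ h0, mul_add, mul_inv_cancel₀ h0.ne']
      exact this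
    · have h0 : 1 - b < 0 := by linarith
      -- For b > 1 the point 0 has to be excluded: `rpow` does not give the value +∞ to 0^(1-b).
      have ht0 : 0 < t := by
        have := hx' h
        rw [ht'] at this
        exact pos_of_mul_pos_right this hy.le
      have h1 : 1 + (1 - b) * (t - 1) < t ^ (1 - b) := by
        rw [Real.rpow_def_of_pos ht0]
        have h2 := Real.add_one_le_exp (Real.log t * (1 - b))
        have h3 := Real.log_lt_sub_one_of_pos ht0 ht1
        nlinarith
      have h4 := mul_lt_mul_of_neg_left h1 (one_div_neg.2 h0)
      rw [mul_add, ← mul_assoc, one_div_mul_cancel h0.ne] at h4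
      linarith
  have hpow : y ^ (-b) * y = y ^ (1 - b) := by
    rw [← Real.rpow_add_one hy.ne']; congr 1; ring
  have hyp : 0 < y ^ (1 - b) := Real.rpow_pos_of_pos hy _
  have e1 : y ^ (-b) * (x - y) = y ^ (1 - b) * (t - 1) := by
    rw [← hpow, ht']; ring
  rw [e1, ht', Real.mul_rpow hy.le ht]
  nlinarith

theorem power_le_tangent {b x y : ℝ} (hb : 0 < b) (hb1 : b ≠ 1) (hy : 0 < y) (hx : 0 ≤ x)
    (hx' : 1 < b → 0 < x) :
    1 / (1 - b) * x ^ (1 - b) ≤ 1 / (1 - b) * y ^ (1 - b) + y ^ (-b) * (x - y) := by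
  rcases eq_or_ne x y with rfl | h
  · simp
  · exact (power_lt_tangent hb hb1 hy hx hx' h).le

theorem power_utility_le {b x y : ℝ} (hb : 0 < b) (hb1 : b ≠ 1) (hx : 0 ≤ x)
    (hx' : 1 < b → 0 < x) (hxy : x ≤ y) :
    1 / (1 - b) * x ^ (1 - b) ≤ 1 / (1 - b) * y ^ (1 - b) := by
  rcases hxy.eq_or_lt with rfl | h
  · exact le_rfl
  have hy : 0 < y := hx.trans_lt h
  have := power_le_tangent hb hb1 hy hx hx'
  have h2 : 0 < y ^ (-b) := Real.rpow_pos_of_pos hy _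
  nlinarith

/-- The tangent to power utility at `x` passes through `(-D, u(w))` iff an explicit equation
holds. -/
theorem tangent_iff {b x w D : ℝ} (hb1 : b ≠ 1) (hx : 0 < x) :
    x ^ (-b) * (b * (x + D) - D) = w ^ (1 - b) ↔
      1 / (1 - b) * x ^ (1 - b) - 1 / (1 - b) * w ^ (1 - b) = x ^ (-b) * (x + D) := by
  have h0 : 1 - b ≠ 0 := sub_ne_zero.2 hb1.symm
  have hpow : x ^ (1 - b) = x ^ (-b) * x := by
    rw [← Real.rpow_add_one hx.ne']; congr 1; ring
  rw [hpow]
  generalize x ^ (-b) = p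
  generalize w ^ (1 - b) = q
  field_simp
  constructor <;> intro h <;> linarith

/-- There is at most one tangent to power utility through a given point. -/
theorem tangent_unique {b x x' c D : ℝ} (hb : 0 < b) (hb1 : b ≠ 1) (hx : 0 < x) (hx' : 0 < x')
    (hD : 0 < x + D) (hD' : 0 < x' + D)
    (h : 1 / (1 - b) * x ^ (1 - b) - c = x ^ (-b) * (x + D))
    (h' : 1 / (1 - b) * x' ^ (1 - b) - c = x' ^ (-b) * (x' + D)) : x = x' := by
  wlog hlt : x < x' generalizing x x'
  · rcases lt_trichotomy x x' with h1 | h1 | h1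
    · exact absurd h1 hlt
    · exact h1
    · exact (this hx' hx hD' hD h' h h1).symm
  -- The tangent at x' lies strictly above the graph at x, so u(x) - c < x'^(-b) (x + D); the larger
  -- slope x^(-b) then contradicts `h`.
  have t1 := power_lt_tangent hb hb1 hx' hx.le (fun _ => hx) hlt.ne
  have t2 : x' ^ (-b) < x ^ (-b) := Real.rpow_lt_rpow_of_neg hx hlt (by linarith)
  nlinarith

theorem continuousAt_tangent_gap {b c D x : ℝ} (hx : 0 < x) :
    ContinuousAt (fun x : ℝ => x ^ (-b) * (x + D) - 1 / (1 - b) * x ^ (1 - b) + c) x := by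
  have h1 := Real.continuousAt_rpow_const x (-b) (Or.inl hx.ne')
  have h2 := Real.continuousAt_rpow_const x (1 - b) (Or.inl hx.ne')
  fun_prop

/-- The tangent at x₀ passes below the point (-D, c) and the tangent at x₁ above it; the height at
-D varies continuously, so some tangent in between hits the point. -/
theorem exists_tangent {b c D x₀ x₁ : ℝ} (h0 : 0 < x₀)
    (hg0 : 1 / (1 - b) * x₀ ^ (1 - b) - c < x₀ ^ (-b) * (x₀ + D))
    (hg1 : x₁ ^ (-b) * (x₁ + D) < 1 / (1 - b) * x₁ ^ (1 - b) - c) (hlt : x₀ < x₁) :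
    ∃ x ∈ Set.Ioo x₀ x₁, 1 / (1 - b) * x ^ (1 - b) - c = x ^ (-b) * (x + D) := by
  have hc : ContinuousOn
      (fun x : ℝ => x ^ (-b) * (x + D) - 1 / (1 - b) * x ^ (1 - b) + c) (Set.Icc x₀ x₁) :=
    fun x hx => (continuousAt_tangent_gap (h0.trans_le hx.1)).continuousWithinAt
  obtain ⟨x, hx, hx0⟩ := intermediate_value_Ioo' hlt.le hc
    (show (0 : ℝ) ∈ _ from ⟨by linarith, by linarith⟩)
  exact ⟨x, hx, by simp only at hx0; linarith⟩

/-- Far out, the tangents to power utility pass above a given point. -/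
theorem exists_tangent_gap_neg {b w : ℝ} (D M : ℝ) (hb : 0 < b) (hb1 : b ≠ 1) (hw : 1 < b → 0 < w) :
    ∃ x > M, 0 < x ∧
      x ^ (-b) * (x + D) < 1 / (1 - b) * x ^ (1 - b) - 1 / (1 - b) * w ^ (1 - b) := by
  have l1 : Tendsto (fun x : ℝ => x ^ (-b)) atTop (𝓝 0) := tendsto_rpow_neg_atTop hb
  have l2 : Tendsto (fun x : ℝ => D * x ^ (-b)) atTop (𝓝 0) := by simpa using l1.const_mul D
  -- Since u(x) - x^(-b) x = b/(1-b) x^(1-b), this is the claim rearranged. For b < 1 the right side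
  -- diverges; for b > 1 the powers of x vanish and u(w) < 0 decides.
  have key : ∀ᶠ x : ℝ in atTop, D * x ^ (-b) + 1 / (1 - b) * w ^ (1 - b) <
      b / (1 - b) * x ^ (1 - b) := by
    rcases lt_or_gt_of_ne hb1 with h | h
    · have h0 : 0 < 1 - b := by linarith
      have l3 : Tendsto (fun x : ℝ => b / (1 - b) * x ^ (1 - b)) atTop atTop :=
        (tendsto_rpow_atTop h0).const_mul_atTop (by positivity)
      have l4 : Tendsto (fun x : ℝ => D * x ^ (-b) + 1 / (1 - b) * w ^ (1 - b)) atTop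
        (𝓝 (0 + 1 / (1 - b) * w ^ (1 - b))) := l2.add_const _
      filter_upwards [l4.eventually_lt_const (lt_add_one _), l3.eventually_gt_atTop _]
        with x e1 e2 using e1.trans e2
    · have h0 : 1 - b < 0 := by linarith
      have l3 : Tendsto (fun x : ℝ => x ^ (1 - b)) atTop (𝓝 0) := by
        have := tendsto_rpow_neg_atTop (y := b - 1) (by linarith)
        simpa using this
      have l4 : Tendsto (fun x : ℝ => b / (1 - b) * x ^ (1 - b)) atTop (𝓝 0) := by
        simpa using l3.const_mul (b / (1 - b))
      have l5 : Tendsto (fun x : ℝ => D * x ^ (-b) + 1 / (1 - b) * w ^ (1 - b)) atTop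
        (𝓝 (0 + 1 / (1 - b) * w ^ (1 - b))) := l2.add_const _
      refine l5.eventually_lt l4 ?_
      have : 0 < w ^ (1 - b) := Real.rpow_pos_of_pos (hw h) _
      have := mul_neg_of_neg_of_pos (one_div_neg.2 h0) this
      linarith
  obtain ⟨x, hx, hxM, hx0⟩ := (key.and ((eventually_gt_atTop M).and (eventually_gt_atTop 0))).exists
  refine ⟨x, hxM, hx0, ?_⟩
  have h0 : 1 - b ≠ 0 := sub_ne_zero.2 hb1.symm
  have hpow : x ^ (1 - b) = x ^ (-b) * x := by
    rw [← Real.rpow_add_one hx0.ne']; congr 1; ring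
  have e : 1 / (1 - b) * x ^ (1 - b) = x ^ (-b) * x + b / (1 - b) * x ^ (1 - b) := by
    rw [hpow]; field_simp; ring
  rw [e]
  linarith

/-- Near zero, the tangents to power utility pass above a given point on the left. -/
theorem exists_tangent_gap_pos {b D ε : ℝ} (hb : b < 1) (hD : 0 < D) (hε : 0 < ε) :
    ∃ x, 0 < x ∧ x < ε ∧ 1 / (1 - b) * x ^ (1 - b) < x ^ (-b) * (x + D) := by
  have h0 : 0 < 1 - b := by linarith
  -- The bound x < (1 - b) D gives x < (1 - b)(x + D), which says that the tangent at x is negative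
  -- at -D.
  obtain ⟨x, hx0, hx⟩ := exists_between (lt_min hε (mul_pos hD h0))
  obtain ⟨hxε, hxD⟩ := lt_min_iff.1 hx
  refine ⟨x, hx0, hxε, ?_⟩
  have hpow : x ^ (1 - b) = x ^ (-b) * x := by
    rw [← Real.rpow_add_one hx0.ne']; congr 1; ring
  have hp : 0 < x ^ (-b) := Real.rpow_pos_of_pos hx0 _
  rw [hpow, one_div, inv_mul_lt_iff₀ h0]
  have : x < (1 - b) * (x + D) := by nlinarith
  nlinarith

/-- Inverse marginal power utility. -/
theorem rpow_neg_inv_rpow_neg {b q : ℝ} (hb : 0 < b) (hq : 0 < q) :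
    (q ^ (-1 / b)) ^ (-b) = q := by
  rw [← Real.rpow_mul hq.le, div_mul_eq_mul_div, neg_mul_neg, one_mul, div_self hb.ne',
    Real.rpow_one]

theorem rpow_neg_rpow_neg_inv {b x : ℝ} (hb : 0 < b) (hx : 0 < x) :
    (x ^ (-b)) ^ (-1 / b) = x := by
  rw [← Real.rpow_mul hx.le, mul_div_assoc', neg_mul_neg, mul_one, div_self hb.ne', Real.rpow_one]

theorem rpow_neg_inv_anti {b q q' : ℝ} (hb : 0 < b) (hq : 0 < q) (h : q < q') :
    q' ^ (-1 / b) < q ^ (-1 / b) :=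
  Real.rpow_lt_rpow_of_neg hq h (div_neg_of_neg_of_pos (by norm_num) hb)

theorem rpow_neg_inv_anti_le {b q q' : ℝ} (hb : 0 < b) (hq : 0 < q) (h : q ≤ q') :
    q' ^ (-1 / b) ≤ q ^ (-1 / b) :=
  Real.rpow_le_rpow_of_nonpos hq h (div_neg_of_neg_of_pos (by norm_num) hb).le

theorem lt_rpow_neg_inv_iff {b q x : ℝ} (hb : 0 < b) (hq : 0 < q) (hx : 0 < x) :
    x < q ^ (-1 / b) ↔ q < x ^ (-b) := by
  have hp : 0 < x ^ (-b) := Real.rpow_pos_of_pos hx _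
  constructor
  · intro h
    by_contra! h'
    have := rpow_neg_inv_anti_le hb hp h'
    rw [rpow_neg_rpow_neg_inv hb hx] at this
    linarith
  · intro h
    have := rpow_neg_inv_anti hb hq h
    rwa [rpow_neg_rpow_neg_inv hb hx] at this

/-! ### The demand function -/

/-- The maximiser of `v ↦ U v - q v` beyond the flat part of the payoff, where `K` is the
kink of the payoff and `k` its value (shifted by the HARA parameter) there. -/
noncomputable def demand (K k α b q : ℝ) : ℝ :=
  K + α⁻¹ * max ((q / α) ^ (-1 / b) - k) 0 + min (q ^ (-1 / b) - k) 0

theorem demand_anti {K k α b q q' : ℝ} (hα : 0 < α) (hb : 0 < b) (hq : 0 < q) (h : q ≤ q') :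
    demand K k α b q' ≤ demand K k α b q := by
  have h1 := rpow_neg_inv_anti_le hb hq h
  have h2 := rpow_neg_inv_anti_le hb (div_pos hq hα) (div_le_div_of_nonneg_right h hα.le)
  unfold demand
  gcongr

theorem continuousAt_demand {K k α b q : ℝ} (hα : 0 < α) (hq : 0 < q) :
    ContinuousAt (demand K k α b) q := by
  have h1 : ContinuousAt (fun q : ℝ => q ^ (-1 / b)) q :=
    Real.continuousAt_rpow_const q _ (Or.inl hq.ne')
  have h2 : ContinuousAt (fun q : ℝ => (q / α) ^ (-1 / b)) q :=
    (continuousAt_id.div_const α).rpow_const (Or.inl (div_pos hq hα).ne')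
  have h3 : ContinuousAt (fun q : ℝ => max ((q / α) ^ (-1 / b) - k) 0) q :=
    (h2.sub continuousAt_const).max continuousAt_const
  have h4 : ContinuousAt (fun q : ℝ => min (q ^ (-1 / b) - k) 0) q :=
    (h1.sub continuousAt_const).min continuousAt_const
  exact (continuousAt_const.add (continuousAt_const.mul h3)).add h4

theorem measurable_demand (K k α b : ℝ) : Measurable (demand K k α b) := by
  unfold demand
  fun_prop

/-- This ordering, due to α ≤ 1, ensures that the `max` and the `min` in `demand` are never both
nonzero. -/
theorem rpow_div_neg_inv_le {α b q : ℝ} (hα : 0 < α) (hα1 : α ≤ 1) (hb : 0 < b) (hq : 0 < q) :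
    (q / α) ^ (-1 / b) ≤ q ^ (-1 / b) :=
  rpow_neg_inv_anti_le hb hq (le_div_self hq.le hα hα1)

theorem demand_of_upper {K k α b q : ℝ} (hα : 0 < α) (hα1 : α ≤ 1) (hb : 0 < b) (hq : 0 < q)
    (h : k ≤ (q / α) ^ (-1 / b)) :
    demand K k α b q = K + α⁻¹ * ((q / α) ^ (-1 / b) - k) := by
  have h2 := rpow_div_neg_inv_le hα hα1 hb hq
  rw [demand, max_eq_left (by linarith), min_eq_right (by linarith), add_zero]

theorem demand_of_middle {K k α b q : ℝ} (h : (q / α) ^ (-1 / b) ≤ k) (h' : k ≤ q ^ (-1 / b)) :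
    demand K k α b q = K := by
  rw [demand, max_eq_right (by linarith), min_eq_right (by linarith)]; simp

theorem demand_of_lower {K k α b q : ℝ} (hα : 0 < α) (hα1 : α ≤ 1) (hb : 0 < b) (hq : 0 < q)
    (h : q ^ (-1 / b) ≤ k) :
    demand K k α b q = K + (q ^ (-1 / b) - k) := by
  have h2 := rpow_div_neg_inv_le hα hα1 hb hq
  rw [demand, max_eq_right (by linarith), min_eq_left (by linarith)]; simp

/-- A growth bound by a power of the price, used to dominate the cost and the terminal value. -/
theorem demand_le {K k α b q : ℝ} (hα : 0 < α) (hα1 : α ≤ 1) (hb : 0 < b) (hq : 0 < q)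
    (hk : 0 ≤ k) : demand K k α b q ≤ K + α⁻¹ * q ^ (-1 / b) := by
  have h1 := rpow_div_neg_inv_le hα hα1 hb hq
  have h2 : 0 < q ^ (-1 / b) := Real.rpow_pos_of_pos hq _
  unfold demand
  have h3 : max ((q / α) ^ (-1 / b) - k) 0 ≤ q ^ (-1 / b) := max_le (by linarith) h2.le
  have h4 : min (q ^ (-1 / b) - k) 0 ≤ 0 := min_le_right _ _
  have h5 := mul_le_mul_of_nonneg_left h3 (inv_pos.2 hα).le
  linarith

/-- The shift from k to k + 1 keeps the threshold positive when k = 0, where the real power 0^(-b)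
would be 0. -/
theorem upper_of_le {k α b q : ℝ} (hα : 0 < α) (hb : 0 < b) (hk : 0 ≤ k) (hq : 0 < q)
    (h : q ≤ α * (k + 1) ^ (-b)) : k + 1 ≤ (q / α) ^ (-1 / b) := by
  have h1 : q / α ≤ (k + 1) ^ (-b) := by rwa [div_le_iff₀' hα]
  have := rpow_neg_inv_anti_le hb (div_pos hq hα) h1
  rwa [rpow_neg_rpow_neg_inv hb (by linarith)] at this

/-- Demand is constant while it sits at the kink, so strictness is only available at low prices.
These have positive probability, which suffices for `cost_strictAnti`. -/
theorem demand_strictAnti {K k α b q q' : ℝ} (hα : 0 < α) (hα1 : α ≤ 1) (hb : 0 < b) (hk : 0 ≤ k)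
    (hq : 0 < q) (h : q < q') (h' : q' ≤ α * (k + 1) ^ (-b)) :
    demand K k α b q' < demand K k α b q := by
  have u1 := upper_of_le hα hb hk hq (h.le.trans h')
  have u2 := upper_of_le hα hb hk (hq.trans h) h'
  rw [demand_of_upper hα hα1 hb hq (by linarith),
    demand_of_upper hα hα1 hb (hq.trans h) (by linarith)]
  have := rpow_neg_inv_anti hb (div_pos hq hα) (div_lt_div_of_pos_right h hα)
  gcongr

/-- Demand is unbounded near zero. -/
theorem exists_demand_ge {α b k : ℝ} (K N : ℝ) (hα : 0 < α) (hα1 : α ≤ 1) (hb : 0 < b)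
    (hk : 0 ≤ k) : ∃ q₀ > 0, ∀ q, 0 < q → q ≤ q₀ → N ≤ demand K k α b q := by
  have hx : 0 < k + 1 + α * |N - K| := by positivity
  have hp := Real.rpow_pos_of_pos hx (-b)
  -- At this price marginal utility puts the shifted payoff at k + 1 + α|N - K|; the excess over k,
  -- divided by α, is at least N - K.
  refine ⟨α * (k + 1 + α * |N - K|) ^ (-b), by positivity, fun q hq hle => ?_⟩
  have h1 : q / α ≤ (k + 1 + α * |N - K|) ^ (-b) := by rwa [div_le_iff₀' hα]
  have h2 := rpow_neg_inv_anti_le hb (div_pos hq hα) h1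
  rw [rpow_neg_rpow_neg_inv hb hx] at h2
  have h0 : 0 ≤ α * |N - K| := by positivity
  rw [demand_of_upper hα hα1 hb hq (by linarith)]
  have h3 : α⁻¹ * (α * |N - K|) ≤ α⁻¹ * ((q / α) ^ (-1 / b) - k) :=
    mul_le_mul_of_nonneg_left (by linarith) (inv_pos.2 hα).le
  rw [inv_mul_cancel_left₀ hα.ne'] at h3
  linarith [le_abs_self (N - K)]

/-! ### The payoff and the utility of the fund value -/

section Payoff

variable {v₀ a b : ℝ} {p : FeeStructure}

theorem flat_pos (hv₀ : 0 < v₀) (hp : p ∈ admissibleFees v₀ a b) :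
    0 < (1 + p.m - p.c) * v₀ := by
  obtain ⟨-, -, -, h, -⟩ := hp
  exact mul_pos (by linarith) hv₀

theorem kink_pos (hv₀ : 0 < v₀) (hp : p ∈ admissibleFees v₀ a b) : 0 < (1 + p.m) * v₀ := by
  obtain ⟨⟨h, -⟩, -⟩ := hp
  exact mul_pos (by linarith) hv₀

theorem flat_le_kink (hv₀ : 0 < v₀) (hp : p ∈ admissibleFees v₀ a b) :
    (1 + p.m - p.c) * v₀ ≤ (1 + p.m) * v₀ := by
  obtain ⟨-, -, ⟨h, -⟩, -⟩ := hp
  exact mul_le_mul_of_nonneg_right (by linarith) hv₀.le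

theorem floor_nonneg (hb1 : b ≠ 1) (hp : p ∈ admissibleFees v₀ a b) :
    0 ≤ v₀ * (p.m - p.c) + a := by
  obtain ⟨-, -, -, -, h, h'⟩ := hp
  rcases lt_or_gt_of_ne hb1 with hb | hb
  · linarith [h hb]
  · linarith [h' hb]

theorem floor_pos (hb : 1 < b) (hp : p ∈ admissibleFees v₀ a b) :
    0 < v₀ * (p.m - p.c) + a := by
  obtain ⟨-, -, -, -, -, h⟩ := hp
  linarith [h hb]

theorem floor_le_kinkValue (hv₀ : 0 < v₀) (hp : p ∈ admissibleFees v₀ a b) :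
    v₀ * (p.m - p.c) + a ≤ p.m * v₀ + a := by
  obtain ⟨-, -, ⟨h, -⟩, -⟩ := hp
  nlinarith

theorem kinkValue_nonneg (hv₀ : 0 < v₀) (hb1 : b ≠ 1) (hp : p ∈ admissibleFees v₀ a b) :
    0 ≤ p.m * v₀ + a :=
  (floor_nonneg hb1 hp).trans (floor_le_kinkValue hv₀ hp)

theorem payoff_of_lt {v : ℝ} (hv : v < (1 + p.m - p.c) * v₀) :
    managerPayoff v₀ p v = v₀ * (p.m - p.c) := by
  rw [managerPayoff, if_pos (by linarith)]

/-- Writing both linear branches as one formula turns the supergradient checks at any point into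
comparisons of slopes with 1 and α. -/
theorem payoff_of_ge {v : ℝ} (hv : (1 + p.m - p.c) * v₀ ≤ v) :
    managerPayoff v₀ p v + a = p.m * v₀ + a + min (v - (1 + p.m) * v₀) 0 +
      p.α * max (v - (1 + p.m) * v₀) 0 := by
  rw [managerPayoff, if_neg (by linarith)]
  split_ifs with h
  · rw [min_eq_left (by linarith), max_eq_right (by linarith)]; ring
  · rw [min_eq_right (by linarith), max_eq_left (by linarith)]; ring

theorem payoff_middle {v : ℝ} (hv : (1 + p.m - p.c) * v₀ ≤ v) (hv' : v ≤ (1 + p.m) * v₀) :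
    managerPayoff v₀ p v + a = v - v₀ + a := by
  rw [payoff_of_ge hv, min_eq_left (by linarith), max_eq_right (by linarith)]; ring

theorem payoff_upper (hv₀ : 0 < v₀) (hp : p ∈ admissibleFees v₀ a b) {v : ℝ}
    (hv' : (1 + p.m) * v₀ ≤ v) :
    managerPayoff v₀ p v + a = p.m * v₀ + a + p.α * (v - (1 + p.m) * v₀) := by
  rw [payoff_of_ge ((flat_le_kink hv₀ hp).trans hv'), min_eq_right (by linarith),
    max_eq_left (by linarith)]; ring

theorem utility_zero (hv₀ : 0 < v₀) (hp : p ∈ admissibleFees v₀ a b) :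
    managerUtility v₀ a b p 0 = 1 / (1 - b) * (v₀ * (p.m - p.c) + a) ^ (1 - b) := by
  rw [managerUtility, hara, payoff_of_lt (flat_pos hv₀ hp)]

theorem utility_of_lt (hv₀ : 0 < v₀) (hp : p ∈ admissibleFees v₀ a b) {v : ℝ}
    (hv : v < (1 + p.m - p.c) * v₀) : managerUtility v₀ a b p v = managerUtility v₀ a b p 0 := by
  rw [managerUtility, managerUtility, payoff_of_lt hv, payoff_of_lt (flat_pos hv₀ hp)]

theorem floor_le_payoff (hv₀ : 0 < v₀) (hp : p ∈ admissibleFees v₀ a b) {v : ℝ}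
    (hv : (1 + p.m - p.c) * v₀ ≤ v) : v₀ * (p.m - p.c) + a ≤ managerPayoff v₀ p v + a := by
  have hα := hp.2.1.1
  rcases le_total v ((1 + p.m) * v₀) with h | h
  · rw [payoff_middle hv h]; linarith
  · rw [payoff_of_ge hv, min_eq_right (by linarith), max_eq_left (by linarith)]
    have h1 : 0 ≤ p.α * (v - (1 + p.m) * v₀) := mul_nonneg hα.le (by linarith)
    obtain ⟨-, -, ⟨h2, -⟩, -⟩ := hp
    nlinarith

theorem payoff_strictMono (hp : p ∈ admissibleFees v₀ a b) {v v' : ℝ}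
    (hv : (1 + p.m - p.c) * v₀ ≤ v) (h : v < v') :
    managerPayoff v₀ p v + a < managerPayoff v₀ p v' + a := by
  have hα := hp.2.1.1
  rw [payoff_of_ge hv, payoff_of_ge (hv.trans h.le)]
  rcases le_total v ((1 + p.m) * v₀) with h1 | h1 <;>
  rcases le_total v' ((1 + p.m) * v₀) with h2 | h2
  · rw [min_eq_left (by linarith), max_eq_right (by linarith), min_eq_left (by linarith),
      max_eq_right (by linarith)]; linarith
  · rw [min_eq_left (by linarith), max_eq_right (by linarith), min_eq_right (by linarith),
      max_eq_left (by linarith)]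
    rcases h1.eq_or_lt with h3 | h3
    · have := mul_pos hα (show 0 < v' - (1 + p.m) * v₀ by linarith)
      linarith
    · have := mul_nonneg hα.le (show 0 ≤ v' - (1 + p.m) * v₀ by linarith)
      linarith
  · linarith
  · rw [min_eq_right (by linarith), max_eq_left (by linarith), min_eq_right (by linarith),
      max_eq_left (by linarith)]
    have := mul_lt_mul_of_pos_left h hα
    linarith

/-- The guaranteed payoff bounds utility from below by a constant, so integrability of a utility
only needs an upper bound. -/
theorem utility_zero_le (hv₀ : 0 < v₀) (hb : 0 < b) (hb1 : b ≠ 1)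
    (hp : p ∈ admissibleFees v₀ a b) (v : ℝ) :
    managerUtility v₀ a b p 0 ≤ managerUtility v₀ a b p v := by
  rcases lt_or_ge v ((1 + p.m - p.c) * v₀) with h | h
  · rw [utility_of_lt hv₀ hp h]
  · rw [utility_zero hv₀ hp]
    exact power_utility_le hb hb1 (floor_nonneg hb1 hp) (fun h => floor_pos h hp)
      (floor_le_payoff hv₀ hp h)

theorem measurable_utility : Measurable (managerUtility v₀ a b p) := by
  have h1 : Measurable (managerPayoff v₀ p) := by
    unfold managerPayoff
    refine Measurable.ite (measurableSet_lt (by fun_prop) (by fun_prop)) (by fun_prop) ?_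
    exact Measurable.ite (measurableSet_lt (by fun_prop) (by fun_prop)) (by fun_prop) (by fun_prop)
  unfold managerUtility hara
  exact ((h1.add_const a).pow_const _).const_mul _

/-- A supergradient of the payoff gives a strict supergradient of the utility. -/
theorem utility_lt_of_payoff_le (hv₀ : 0 < v₀) (hb : 0 < b) (hb1 : b ≠ 1)
    (hp : p ∈ admissibleFees v₀ a b) {v v' q κ : ℝ} (hv : (1 + p.m - p.c) * v₀ ≤ v)
    (hv' : (1 + p.m - p.c) * v₀ ≤ v') (hne : v ≠ v') (hpos : 0 < managerPayoff v₀ p v' + a)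
    (hq : q = κ * (managerPayoff v₀ p v' + a) ^ (-b))
    (h : managerPayoff v₀ p v + a ≤ managerPayoff v₀ p v' + a + κ * (v - v')) :
    managerUtility v₀ a b p v - q * v < managerUtility v₀ a b p v' - q * v' := by
  have hne' : managerPayoff v₀ p v + a ≠ managerPayoff v₀ p v' + a := by
    rcases lt_or_gt_of_ne hne with h1 | h1
    · exact (payoff_strictMono hp hv h1).ne
    · exact (payoff_strictMono hp hv' h1).ne'
  have h0 := floor_le_payoff hv₀ hp hv
  have := power_lt_tangent hb hb1 hpos ((floor_nonneg hb1 hp).trans h0)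
    (fun h => (floor_pos h hp).trans_le h0) hne'
  have hz : 0 < (managerPayoff v₀ p v' + a) ^ (-b) := Real.rpow_pos_of_pos hpos _
  have h2 := mul_le_mul_of_nonneg_left h hz.le
  rw [managerUtility, managerUtility, hara, hara, hq]
  linarith

/-- The demand function is the strict maximiser beyond the flat part of the payoff. -/
theorem utility_lt_demand (hv₀ : 0 < v₀) (hb : 0 < b) (hb1 : b ≠ 1)
    (hp : p ∈ admissibleFees v₀ a b) {v q : ℝ} (hq : 0 < q)
    (hI : (1 + p.m - p.c) * v₀ ≤ demand ((1 + p.m) * v₀) (p.m * v₀ + a) p.α b q)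
    (hv : (1 + p.m - p.c) * v₀ ≤ v)
    (hne : v ≠ demand ((1 + p.m) * v₀) (p.m * v₀ + a) p.α b q) :
    managerUtility v₀ a b p v - q * v <
      managerUtility v₀ a b p (demand ((1 + p.m) * v₀) (p.m * v₀ + a) p.α b q) -
        q * demand ((1 + p.m) * v₀) (p.m * v₀ + a) p.α b q := by
  obtain ⟨hα, hα1⟩ := hp.2.1
  set k := p.m * v₀ + a with hk
  have hk0 : 0 ≤ k := kinkValue_nonneg hv₀ hb1 hp
  have hξ : 0 < q ^ (-1 / b) := Real.rpow_pos_of_pos hq _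
  have hη : 0 < (q / p.α) ^ (-1 / b) := Real.rpow_pos_of_pos (div_pos hq hα) _
  have eη := rpow_neg_inv_rpow_neg hb (div_pos hq hα)
  have eξ := rpow_neg_inv_rpow_neg hb hq
  have hvX := payoff_of_ge (a := a) hv
  rw [← hk] at hvX
  rcases le_or_gt k ((q / p.α) ^ (-1 / b)) with h1 | h1
  · have e := demand_of_upper (K := (1 + p.m) * v₀) hα hα1 hb hq h1
    have hge : (1 + p.m) * v₀ ≤ demand ((1 + p.m) * v₀) k p.α b q := by
      rw [e]
      have := mul_nonneg (inv_pos.2 hα).le (sub_nonneg.2 h1)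
      linarith
    have hX : managerPayoff v₀ p (demand ((1 + p.m) * v₀) k p.α b q) + a
        = (q / p.α) ^ (-1 / b) := by
      rw [payoff_upper hv₀ hp hge, e, ← hk, add_sub_cancel_left, mul_inv_cancel_left₀ hα.ne']
      ring
    refine utility_lt_of_payoff_le (κ := p.α) hv₀ hb hb1 hp hv hI hne ?_ ?_ ?_
    · rw [hX]; exact hη
    · rw [hX, eη]; field_simp
    · have : p.α * (v - demand ((1 + p.m) * v₀) k p.α b q)
          = p.α * (v - (1 + p.m) * v₀) - ((q / p.α) ^ (-1 / b) - k) := by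
        rw [e]; field_simp; ring
      rw [this, hX, hvX]
      rcases le_total v ((1 + p.m) * v₀) with h2 | h2
      · rw [min_eq_left (by linarith), max_eq_right (by linarith)]
        nlinarith
      · rw [min_eq_right (by linarith), max_eq_left (by linarith)]
        linarith
  rcases le_or_gt k (q ^ (-1 / b)) with h2 | h2
  · have e := demand_of_middle (K := (1 + p.m) * v₀) h1.le h2
    have hkpos : 0 < k := hη.trans h1
    have hX : managerPayoff v₀ p (demand ((1 + p.m) * v₀) k p.α b q) + a = k := by
      rw [e, payoff_upper hv₀ hp le_rfl, sub_self, mul_zero, add_zero]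
    have hkb : 0 < k ^ (-b) := Real.rpow_pos_of_pos hkpos _
    have hq1 : q ≤ k ^ (-b) := by
      have := Real.rpow_le_rpow_of_nonpos hkpos h2 (neg_nonpos.2 hb.le)
      rwa [eξ] at this
    have hq2 : p.α * k ^ (-b) ≤ q := by
      have := Real.rpow_le_rpow_of_nonpos hη h1.le (neg_nonpos.2 hb.le)
      rwa [eη, le_div_iff₀' hα] at this
    -- At the kink every κ in [α, 1] is a supergradient of the payoff; this regime is exactly the
    -- range of q for which κ k^(-b) = q has such a solution. The other two regimes use the
    -- endpoints κ = α and κ = 1.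
    refine utility_lt_of_payoff_le (κ := q / k ^ (-b)) hv₀ hb hb1 hp hv hI hne ?_ ?_ ?_
    · rw [hX]; exact hkpos
    · rw [hX]; field_simp
    · have k1 : q / k ^ (-b) ≤ 1 := (div_le_one hkb).2 hq1
      have k2 : p.α ≤ q / k ^ (-b) := (le_div_iff₀ hkb).2 hq2
      rw [hX, hvX, e]
      rcases le_total v ((1 + p.m) * v₀) with h3 | h3
      · rw [min_eq_left (by linarith), max_eq_right (by linarith)]
        nlinarith
      · rw [min_eq_right (by linarith), max_eq_left (by linarith)]
        nlinarith
  · have e := demand_of_lower (K := (1 + p.m) * v₀) hα hα1 hb hq h2.le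
    have hX : managerPayoff v₀ p (demand ((1 + p.m) * v₀) k p.α b q) + a = q ^ (-1 / b) := by
      rw [payoff_middle hI (by rw [e]; linarith), e, hk]; ring
    refine utility_lt_of_payoff_le (κ := 1) hv₀ hb hb1 hp hv hI hne ?_ ?_ ?_
    · rw [hX]; exact hξ
    · rw [hX, eξ, one_mul]
    · rw [hX, hvX, e]
      rcases le_total v ((1 + p.m) * v₀) with h3 | h3
      · rw [min_eq_left (by linarith), max_eq_right (by linarith)]
        linarith
      · rw [min_eq_right (by linarith), max_eq_left (by linarith)]
        nlinarith

end Payoff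

/-! ### Concave envelopes -/

/-- The supporting line at a convex combination dominates f at both endpoints, and averaging the two
inequalities gives convexity of the hypograph. -/
theorem isConcaveExt_of_supergradient {f : ℝ → ℝ}
    (h : ∀ x ≥ 0, ∃ q : ℝ, ∀ w ≥ 0, f w ≤ f x + q * (w - x)) : IsConcaveExt (extendBot f) := by
  refine ⟨fun v => ?_, ?_⟩
  · unfold extendBot; split_ifs <;> simp
  · have key : {q : ℝ × ℝ | (q.2 : EReal) ≤ extendBot f q.1} = {q | 0 ≤ q.1 ∧ q.2 ≤ f q.1} := by
      ext ⟨x, y⟩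
      simp only [extendBot, Set.mem_ofPred_eq]
      split_ifs with hx
      · simp [hx]
      · simp only [EReal.coe_le_coe_iff]
        exact ⟨fun h => ⟨not_lt.1 hx, h⟩, fun h => h.2⟩
    rw [key]
    rintro ⟨x, y⟩ ⟨hx, hy⟩ ⟨x', y'⟩ ⟨hx', hy'⟩ s t hs ht hst
    simp only [Prod.smul_mk, Prod.mk_add_mk, smul_eq_mul, Set.mem_ofPred_eq] at *
    have h0 : 0 ≤ s * x + t * x' := by positivity
    refine ⟨h0, ?_⟩
    obtain ⟨q, hq⟩ := h _ h0
    have h1 := mul_le_mul_of_nonneg_left (hy.trans (hq x hx)) hs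
    have h2 := mul_le_mul_of_nonneg_left (hy'.trans (hq x' hx')) ht
    have e : f (s * x + t * x') = s * f (s * x + t * x') + t * f (s * x + t * x') := by
      rw [← add_mul, hst, one_mul]
    have e2 : s * (q * (x - (s * x + t * x'))) + t * (q * (x' - (s * x + t * x'))) = 0 := by
      have : t = 1 - s := by linarith
      subst this; ring
    linarith

/-- Minimality holds because a concave majorant lies above the chord between two points of the
graph. Concavity holds because the supporting lines of U also support the modified function. -/
theorem isConcaveEnvelope_chordThen {U : ℝ → ℝ} {θ : ℝ} (hθ : 0 < θ)
    (hchord : ∀ w ≥ 0, U w ≤ U 0 + chordSlope U θ * w)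
    (hsup : ∀ x ≥ θ, ∃ q : ℝ, ∀ w ≥ 0, U w ≤ U x + q * (w - x)) :
    IsConcaveEnvelope (chordThen U θ) (extendBot U) := by
  have hsθ : U θ = U 0 + chordSlope U θ * θ := by
    rw [chordSlope, div_mul_cancel₀ _ hθ.ne']; ring
  set s := chordSlope U θ with hs
  set f : ℝ → ℝ := fun v => if v < θ then U 0 + s * v else U v with hf
  have hfe : chordThen U θ = extendBot f := by
    ext v
    simp only [chordThen, extendBot, hf, ← hs]
    split_ifs <;> rfl
  -- An affine majorant of U dominates the chord, because it does so at the endpoints 0 and θ.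
  have hfle : ∀ A q : ℝ, (∀ w ≥ 0, U w ≤ A + q * w) → ∀ w ≥ 0, f w ≤ A + q * w := by
    intro A q h w hw
    simp only [hf]
    split_ifs with hlt
    · have h0 := h 0 le_rfl
      have h1 := h θ hθ.le
      rw [hsθ] at h1
      have : (θ - w) * (A - U 0) + w * (A + q * θ - (U 0 + s * θ)) ≥ 0 :=
        add_nonneg (mul_nonneg (by linarith) (by linarith)) (mul_nonneg hw (by linarith))
      have : 0 ≤ θ * (A + q * w - (U 0 + s * w)) := by linarith
      have := nonneg_of_mul_nonneg_right this hθ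
      linarith
    · exact h w hw
  refine ⟨?_, ?_, ?_⟩
  · rw [hfe]
    refine isConcaveExt_of_supergradient fun x hx => ?_
    rcases lt_or_ge x θ with hlt | hge
    · refine ⟨s, fun w hw => ?_⟩
      have := hfle _ _ hchord w hw
      have e : f x = U 0 + s * x := if_pos hlt
      rw [e]; linarith
    · obtain ⟨q, hq⟩ := hsup x hge
      refine ⟨q, fun w hw => ?_⟩
      have := hfle (U x - q * x) q (fun w hw => by linarith [hq w hw]) w hw
      have e : f x = U x := if_neg (not_lt.2 hge)
      rw [e]; linarith
  · intro v
    simp only [chordThen, extendBot, ← hs]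
    split_ifs with h1 h2
    · exact le_rfl
    · exact EReal.coe_le_coe_iff.2 (hchord v (not_lt.1 h1))
    · exact le_rfl
  · intro g hg hUg v
    have hreal : ∀ w ≥ 0, ((U w : ℝ) : EReal) ≤ g w := by
      intro w hw
      have := hUg w
      rwa [extendBot, if_neg (not_lt.2 hw)] at this
    simp only [chordThen, ← hs]
    split_ifs with h1 h2
    · exact bot_le
    · have hv : 0 ≤ v := not_lt.1 h1
      have hx : ((0 : ℝ), U 0) ∈ {q : ℝ × ℝ | (q.2 : EReal) ≤ g q.1} := hreal 0 le_rfl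
      have hy : (θ, U θ) ∈ {q : ℝ × ℝ | (q.2 : EReal) ≤ g q.1} := hreal θ hθ.le
      have h3 : 0 ≤ 1 - v / θ := by rw [sub_nonneg, div_le_one hθ]; exact h2.le
      have h4 : 0 ≤ v / θ := by positivity
      have := hg.2 hx hy h3 h4 (by ring)
      simp only [Prod.smul_mk, Prod.mk_add_mk, smul_eq_mul, Set.mem_ofPred_eq, mul_zero,
        zero_add, div_mul_cancel₀ _ hθ.ne'] at this
      have e : U 0 + s * v = (1 - v / θ) * U 0 + v / θ * U θ := by
        rw [hsθ]; field_simp; ring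
      rwa [e]
    · exact hreal v (not_lt.1 h1)

theorem isConcaveEnvelope_unique {u u' f : ℝ → EReal} (h : IsConcaveEnvelope u f)
    (h' : IsConcaveEnvelope u' f) : u = u' :=
  funext fun v => le_antisymm (h.2.2 _ h'.1 h'.2.1 v) (h'.2.2 _ h.1 h.2.1 v)

/-- A tangent point of the line through `(0, U 0)`, in terms of the demand function. -/
structure IsTangentPoint (v₀ a b : ℝ) (p : FeeStructure) (s θ : ℝ) : Prop where
  flat_le : (1 + p.m - p.c) * v₀ ≤ θ
  slope_pos : 0 < s
  slope_mul : s * θ = managerUtility v₀ a b p θ - managerUtility v₀ a b p 0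
  demand_eq : demand ((1 + p.m) * v₀) (p.m * v₀ + a) p.α b s = θ

section Tangent

variable {v₀ a b s θ : ℝ} {p : FeeStructure}

theorem IsTangentPoint.pos (h : IsTangentPoint v₀ a b p s θ) (hv₀ : 0 < v₀)
    (hp : p ∈ admissibleFees v₀ a b) : 0 < θ :=
  (flat_pos hv₀ hp).trans_le h.flat_le

theorem IsTangentPoint.chordSlope_eq (h : IsTangentPoint v₀ a b p s θ) (hv₀ : 0 < v₀)
    (hp : p ∈ admissibleFees v₀ a b) : chordSlope (managerUtility v₀ a b p) θ = s := by
  rw [chordSlope, ← h.slope_mul, mul_div_cancel_right₀ _ (h.pos hv₀ hp).ne']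

theorem IsTangentPoint.le_demand (h : IsTangentPoint v₀ a b p s θ) (hb : 0 < b)
    (hp : p ∈ admissibleFees v₀ a b) {q : ℝ} (hq : 0 < q) (hqs : q ≤ s) :
    θ ≤ demand ((1 + p.m) * v₀) (p.m * v₀ + a) p.α b q := by
  have := demand_anti (K := (1 + p.m) * v₀) (k := p.m * v₀ + a) hp.2.1.1 hb hq hqs
  rwa [h.demand_eq] at this

theorem IsTangentPoint.lt_demand (h : IsTangentPoint v₀ a b p s θ) (hv₀ : 0 < v₀) (hb : 0 < b)
    (hb1 : b ≠ 1) (hp : p ∈ admissibleFees v₀ a b) {q v : ℝ} (hq : 0 < q) (hqs : q ≤ s)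
    (hv : (1 + p.m - p.c) * v₀ ≤ v)
    (hne : v ≠ demand ((1 + p.m) * v₀) (p.m * v₀ + a) p.α b q) :
    managerUtility v₀ a b p v - q * v <
      managerUtility v₀ a b p (demand ((1 + p.m) * v₀) (p.m * v₀ + a) p.α b q) -
        q * demand ((1 + p.m) * v₀) (p.m * v₀ + a) p.α b q :=
  utility_lt_demand hv₀ hb hb1 hp hq (h.flat_le.trans (h.le_demand hb hp hq hqs)) hv hne

/-- At price q the choice θ has net value U(0) + (s - q)θ, and demand does at least as well as θ.
For q < s the surplus (s - q)θ rules out the flat part. -/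
theorem IsTangentPoint.zero_le_demand (h : IsTangentPoint v₀ a b p s θ) (hv₀ : 0 < v₀) (hb : 0 < b)
    (hb1 : b ≠ 1) (hp : p ∈ admissibleFees v₀ a b) {q : ℝ} (hq : 0 < q) (hqs : q ≤ s) :
    managerUtility v₀ a b p 0 + (s - q) * θ ≤
      managerUtility v₀ a b p (demand ((1 + p.m) * v₀) (p.m * v₀ + a) p.α b q) -
        q * demand ((1 + p.m) * v₀) (p.m * v₀ + a) p.α b q := by
  have h1 := h.slope_mul
  rcases eq_or_ne θ (demand ((1 + p.m) * v₀) (p.m * v₀ + a) p.α b q) with h2 | h2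
  · rw [← h2]; linarith
  · have := h.lt_demand hv₀ hb hb1 hp hq hqs h.flat_le h2
    linarith

/-- At price s the demand is θ with net value U(0), so no point beyond the flat part exceeds the
chord line; on the flat part the line increases from U(0). -/
theorem IsTangentPoint.utility_le (h : IsTangentPoint v₀ a b p s θ) (hv₀ : 0 < v₀) (hb : 0 < b)
    (hb1 : b ≠ 1) (hp : p ∈ admissibleFees v₀ a b) {v : ℝ} (hv : 0 ≤ v) :
    managerUtility v₀ a b p v ≤ managerUtility v₀ a b p 0 + s * v := by
  rcases lt_or_ge v ((1 + p.m - p.c) * v₀) with h1 | h1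
  · rw [utility_of_lt hv₀ hp h1]
    have := mul_nonneg h.slope_pos.le hv
    linarith
  · have h3 := h.slope_mul
    rcases eq_or_ne v θ with rfl | h2
    · linarith
    · have := h.lt_demand hv₀ hb hb1 hp h.slope_pos le_rfl h1 (by rwa [h.demand_eq])
      rw [h.demand_eq] at this
      linarith

theorem IsTangentPoint.utility_lt (h : IsTangentPoint v₀ a b p s θ) (hv₀ : 0 < v₀) (hb : 0 < b)
    (hb1 : b ≠ 1) (hp : p ∈ admissibleFees v₀ a b) {v : ℝ} (hv : (1 + p.m - p.c) * v₀ ≤ v)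
    (hne : v ≠ θ) : managerUtility v₀ a b p v < managerUtility v₀ a b p 0 + s * v := by
  have h3 := h.slope_mul
  have := h.lt_demand hv₀ hb hb1 hp h.slope_pos le_rfl hv (by rwa [h.demand_eq])
  rw [h.demand_eq] at this
  linarith

/-- The pointwise optimal value: demand if the price is at most `s`, and zero otherwise. -/
noncomputable def optimalValue (v₀ a b : ℝ) (p : FeeStructure) (s q : ℝ) : ℝ :=
  if q ≤ s then demand ((1 + p.m) * v₀) (p.m * v₀ + a) p.α b q else 0

/-- At q = s both 0 and θ are maximisers, so uniqueness fails there and only there. Below s the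
surplus of `zero_le_demand` excludes the flat part; above s the chord bound makes every v > 0 worse
than 0. -/
theorem IsTangentPoint.lt_optimalValue (h : IsTangentPoint v₀ a b p s θ) (hv₀ : 0 < v₀)
    (hb : 0 < b) (hb1 : b ≠ 1) (hp : p ∈ admissibleFees v₀ a b) {q v : ℝ} (hq : 0 < q)
    (hqs : q ≠ s) (hv : 0 ≤ v) (hne : v ≠ optimalValue v₀ a b p s q) :
    managerUtility v₀ a b p v - q * v <
      managerUtility v₀ a b p (optimalValue v₀ a b p s q) - q * optimalValue v₀ a b p s q := by
  unfold optimalValue at *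
  split_ifs at * with hle
  · rcases lt_or_ge v ((1 + p.m - p.c) * v₀) with h1 | h1
    · have h2 := h.zero_le_demand hv₀ hb hb1 hp hq hle
      have h3 : 0 < (s - q) * θ :=
        mul_pos (sub_pos.2 (lt_of_le_of_ne hle hqs)) (h.pos hv₀ hp)
      rw [utility_of_lt hv₀ hp h1]
      have := mul_nonneg hq.le hv
      linarith
    · exact h.lt_demand hv₀ hb hb1 hp hq hle h1 hne
  · have h1 := h.utility_le hv₀ hb hb1 hp hv
    have h2 : s * v < q * v :=
      mul_lt_mul_of_pos_right (not_le.1 hle) (lt_of_le_of_ne hv (Ne.symm hne))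
    linarith

theorem IsTangentPoint.le_optimalValue (h : IsTangentPoint v₀ a b p s θ) (hv₀ : 0 < v₀)
    (hb : 0 < b) (hb1 : b ≠ 1) (hp : p ∈ admissibleFees v₀ a b) {q v : ℝ} (hq : 0 < q)
    (hv : 0 ≤ v) :
    managerUtility v₀ a b p v - q * v ≤
      managerUtility v₀ a b p (optimalValue v₀ a b p s q) - q * optimalValue v₀ a b p s q := by
  rcases eq_or_ne q s with rfl | hqs
  · rw [optimalValue, if_pos le_rfl, h.demand_eq]
    linarith [h.utility_le hv₀ hb hb1 hp hv, h.slope_mul]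
  · rcases eq_or_ne v (optimalValue v₀ a b p s q) with h1 | h1
    · rw [← h1]
    · exact (h.lt_optimalValue hv₀ hb hb1 hp hq hqs hv h1).le

/-- Demand runs continuously from θ at price s to arbitrarily large values near price 0. The price
at which x is demanded serves as a supergradient of U at x. -/
theorem IsTangentPoint.exists_demand_eq (h : IsTangentPoint v₀ a b p s θ) (hv₀ : 0 < v₀)
    (hb : 0 < b) (hb1 : b ≠ 1) (hp : p ∈ admissibleFees v₀ a b) {x : ℝ} (hx : θ ≤ x) :
    ∃ q, 0 < q ∧ q ≤ s ∧ demand ((1 + p.m) * v₀) (p.m * v₀ + a) p.α b q = x := by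
  obtain ⟨hα, hα1⟩ := hp.2.1
  obtain ⟨q₀, hq₀, hN⟩ := exists_demand_ge ((1 + p.m) * v₀) x hα hα1 hb
    (kinkValue_nonneg hv₀ hb1 hp)
  have h1 : 0 < min q₀ s := lt_min hq₀ h.slope_pos
  have hc : ContinuousOn (demand ((1 + p.m) * v₀) (p.m * v₀ + a) p.α b)
      (Set.Icc (min q₀ s) s) :=
    fun q hq => (continuousAt_demand hα (h1.trans_le hq.1)).continuousWithinAt
  obtain ⟨q, hq, e⟩ := intermediate_value_Icc' (min_le_right _ _) hc
    (show x ∈ _ from ⟨h.demand_eq.trans_le hx, hN _ h1 (min_le_left _ _)⟩)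
  exact ⟨q, h1.trans_le hq.1, hq.2, e⟩

theorem IsTangentPoint.isConcavificationPoint (h : IsTangentPoint v₀ a b p s θ) (hv₀ : 0 < v₀)
    (hb : 0 < b) (hb1 : b ≠ 1) (hp : p ∈ admissibleFees v₀ a b) :
    IsConcavificationPoint v₀ a b p θ := by
  refine ⟨h.flat_le, isConcaveEnvelope_chordThen (h.pos hv₀ hp) ?_ ?_⟩
  · intro w hw
    rw [h.chordSlope_eq hv₀ hp]
    exact h.utility_le hv₀ hb hb1 hp hw
  · intro x hx
    obtain ⟨q, hq, hqs, e⟩ := h.exists_demand_eq hv₀ hb hb1 hp hx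
    refine ⟨q, fun w hw => ?_⟩
    have := h.le_optimalValue hv₀ hb hb1 hp hq hw
    rw [optimalValue, if_pos hqs, e] at this
    linarith

theorem IsTangentPoint.isConcavificationPoint_iff (h : IsTangentPoint v₀ a b p s θ) (hv₀ : 0 < v₀)
    (hb : 0 < b) (hb1 : b ≠ 1) (hp : p ∈ admissibleFees v₀ a b) (v : ℝ) :
    IsConcavificationPoint v₀ a b p v ↔ v = θ := by
  have hθ := h.isConcavificationPoint hv₀ hb hb1 hp
  have hθ0 := h.pos hv₀ hp
  refine ⟨fun hv => ?_, fun e => e ▸ hθ⟩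
  have hv0 : 0 < v := (flat_pos hv₀ hp).trans_le hv.1
  have e := isConcaveEnvelope_unique hv.2 hθ.2
  by_contra hne
  -- If v < θ, the two envelopes at v would equate U(v) with the strictly larger chord. If v > θ,
  -- comparison at θ forces the chord slope s, and a point strictly between θ and v gives the same
  -- contradiction.
  rcases lt_or_gt_of_ne hne with hlt | hlt
  · have e1 := congrFun e v
    rw [chordThen, chordThen, if_neg hv0.not_gt, if_neg hv0.not_gt, if_neg (lt_irrefl _),
      if_pos hlt, h.chordSlope_eq hv₀ hp, EReal.coe_eq_coe_iff] at e1
    exact (h.utility_lt hv₀ hb hb1 hp hv.1 hne).ne e1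
  · have e1 := congrFun e θ
    rw [chordThen, chordThen, if_neg hθ0.not_gt, if_neg hθ0.not_gt, if_neg (lt_irrefl _),
      if_pos hlt, EReal.coe_eq_coe_iff] at e1
    have h1 := h.slope_mul
    have hs : chordSlope (managerUtility v₀ a b p) v = s :=
      mul_right_cancel₀ hθ0.ne' (by linarith)
    obtain ⟨t, ht, ht'⟩ := exists_between hlt
    have ht0 : 0 < t := hθ0.trans ht
    have e2 := congrFun e t
    rw [chordThen, chordThen, if_neg ht0.not_gt, if_neg ht0.not_gt, if_pos ht',
      if_neg ht.not_gt, hs, EReal.coe_eq_coe_iff] at e2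
    exact (h.utility_lt hv₀ hb hb1 hp (h.flat_le.trans ht.le) ht.ne').ne e2.symm

end Tangent

/-! ### The optimal value as a function of the price -/

section OptimalValue

variable {v₀ a b s θ : ℝ} {p : FeeStructure}

theorem IsTangentPoint.optimalValue_nonneg (h : IsTangentPoint v₀ a b p s θ) (hv₀ : 0 < v₀)
    (hb : 0 < b) (hp : p ∈ admissibleFees v₀ a b) {q : ℝ} (hq : 0 < q) :
    0 ≤ optimalValue v₀ a b p s q := by
  unfold optimalValue
  split_ifs with hle
  · exact (h.pos hv₀ hp).le.trans (h.le_demand hb hp hq hle)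
  · exact le_rfl

theorem IsTangentPoint.optimalValue_anti (h : IsTangentPoint v₀ a b p s θ) (hv₀ : 0 < v₀)
    (hb : 0 < b) (hp : p ∈ admissibleFees v₀ a b) {q q' : ℝ} (hq : 0 < q) (hle : q ≤ q') :
    optimalValue v₀ a b p s q' ≤ optimalValue v₀ a b p s q := by
  by_cases h' : q' ≤ s
  · rw [optimalValue, optimalValue, if_pos h', if_pos (hle.trans h')]
    exact demand_anti hp.2.1.1 hb hq hle
  · rw [optimalValue, if_neg h']
    exact h.optimalValue_nonneg hv₀ hb hp hq

theorem optimalValue_le (hv₀ : 0 < v₀) (hb : 0 < b) (hb1 : b ≠ 1)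
    (hp : p ∈ admissibleFees v₀ a b) {q : ℝ} (hq : 0 < q) :
    optimalValue v₀ a b p s q ≤ (1 + p.m) * v₀ + p.α⁻¹ * q ^ (-1 / b) := by
  obtain ⟨hα, hα1⟩ := hp.2.1
  unfold optimalValue
  split_ifs
  · exact demand_le hα hα1 hb hq (kinkValue_nonneg hv₀ hb1 hp)
  · have h1 := kink_pos hv₀ hp
    have h2 : 0 < q ^ (-1 / b) := Real.rpow_pos_of_pos hq _
    positivity

theorem measurable_optimalValue : Measurable (optimalValue v₀ a b p s) :=
  Measurable.ite measurableSet_Iic (measurable_demand _ _ _ _) measurable_const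

/-- The only possible discontinuity at positive prices is q = s, a null event for an atomless price.
-/
theorem continuousAt_optimalValue (hp : p ∈ admissibleFees v₀ a b) {q : ℝ} (hq : 0 < q)
    (hqs : q ≠ s) : ContinuousAt (optimalValue v₀ a b p s) q := by
  rcases lt_or_gt_of_ne hqs with h | h
  · refine (continuousAt_demand (K := (1 + p.m) * v₀) (k := p.m * v₀ + a) (b := b)
      hp.2.1.1 hq).congr ?_
    filter_upwards [eventually_lt_nhds h] with x hx
    rw [optimalValue, if_pos hx.le]
  · refine (continuousAt_const (y := (0 : ℝ))).congr ?_
    filter_upwards [eventually_gt_nhds h] with x hx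
    rw [optimalValue, if_neg hx.not_ge]

end OptimalValue

/-! ### The expected utility problem -/

/-- The properties of the state price density at the horizon that the optimisation depends on. -/
structure IsRegularPrice {Ω : Type*} {mΩ : MeasurableSpace Ω} (Q : Measure Ω)
    (mT : MeasurableSpace Ω) (Z : Ω → ℝ) : Prop where
  le : mT ≤ mΩ
  meas : Measurable[mT] Z
  pos : ∀ ω, 0 < Z ω
  integrable_rpow : ∀ r : ℝ, Integrable (fun ω => Z ω ^ r) Q
  ae_ne : ∀ c : ℝ, ∀ᵐ ω ∂Q, Z ω ≠ c
  small : ∀ ε > 0, Q {ω | Z ω < ε} ≠ 0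

section Problem

variable {Ω : Type*} {mT : MeasurableSpace Ω} {mΩ : MeasurableSpace Ω} {Q : Measure Ω}
  {Z : Ω → ℝ} {v₀ a b s θ : ℝ} {p : FeeStructure}

theorem IsRegularPrice.measurable (hZ : IsRegularPrice Q mT Z) : Measurable Z :=
  hZ.meas.mono hZ.le le_rfl

theorem IsRegularPrice.integrable (hZ : IsRegularPrice Q mT Z) : Integrable Z Q := by
  simpa using hZ.integrable_rpow 1

theorem IsRegularPrice.measurable_optimalValue (hZ : IsRegularPrice Q mT Z) (y : ℝ) :
    Measurable (fun ω => optimalValue v₀ a b p s (y * Z ω)) :=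
  FirstLoss.measurable_optimalValue.comp (hZ.measurable.const_mul y)

theorem IsRegularPrice.setIntegral_pos (hZ : IsRegularPrice Q mT Z) :
    0 < ∫ ω in {ω | Z ω < 1}, Z ω ∂Q := by
  rw [setIntegral_pos_iff_support_of_nonneg_ae (ae_of_all _ fun ω => (hZ.pos ω).le)
    hZ.integrable.integrableOn]
  have : Function.support Z = Set.univ := by
    ext ω; simp [(hZ.pos ω).ne']
  rw [this, Set.univ_inter]
  exact pos_iff_ne_zero.2 (hZ.small 1 one_pos)

theorem IsTangentPoint.integrable_cost (h : IsTangentPoint v₀ a b p s θ)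
    (hZ : IsRegularPrice Q mT Z) (hv₀ : 0 < v₀) (hb : 0 < b) (hb1 : b ≠ 1)
    (hp : p ∈ admissibleFees v₀ a b) {y : ℝ} (hy : 0 < y) :
    Integrable (fun ω => Z ω * optimalValue v₀ a b p s (y * Z ω)) Q := by
  refine Integrable.mono'
    (g := fun ω => (1 + p.m) * v₀ * Z ω + p.α⁻¹ * y ^ (-1 / b) * Z ω ^ (-1 / b + 1))
    ((hZ.integrable.const_mul _).add ((hZ.integrable_rpow _).const_mul _))
    (hZ.measurable.mul (hZ.measurable_optimalValue y)).aestronglyMeasurable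
    (ae_of_all _ fun ω => ?_)
  have hz := hZ.pos ω
  have hq := mul_pos hy hz
  rw [Real.norm_of_nonneg (mul_nonneg hz.le (h.optimalValue_nonneg hv₀ hb hp hq)),
    Real.rpow_add_one hz.ne']
  have := mul_le_mul_of_nonneg_left (optimalValue_le (s := s) hv₀ hb hb1 hp hq) hz.le
  rw [Real.mul_rpow hy.le hz.le] at this
  linarith

theorem IsTangentPoint.continuousAt_cost (h : IsTangentPoint v₀ a b p s θ)
    (hZ : IsRegularPrice Q mT Z) (hv₀ : 0 < v₀) (hb : 0 < b) (hb1 : b ≠ 1)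
    (hp : p ∈ admissibleFees v₀ a b) {y : ℝ} (hy : 0 < y) :
    ContinuousAt (fun y => ∫ ω, Z ω * optimalValue v₀ a b p s (y * Z ω) ∂Q) y := by
  -- The value decreases in the multiplier, so the integrand at y/2 dominates all those for nearby
  -- multipliers.
  refine continuousAt_of_dominated
    (bound := fun ω => Z ω * optimalValue v₀ a b p s (y / 2 * Z ω)) ?_ ?_
    (h.integrable_cost hZ hv₀ hb hb1 hp (half_pos hy)) ?_
  · exact Eventually.of_forall fun y' =>
      (hZ.measurable.mul (hZ.measurable_optimalValue y')).aestronglyMeasurable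
  · filter_upwards [eventually_gt_nhds (half_lt_self hy)] with y' hy'
    refine ae_of_all _ fun ω => ?_
    have hz := hZ.pos ω
    have hq := mul_pos ((half_pos hy).trans hy') hz
    rw [Real.norm_of_nonneg (mul_nonneg hz.le (h.optimalValue_nonneg hv₀ hb hp hq))]
    exact mul_le_mul_of_nonneg_left (h.optimalValue_anti hv₀ hb hp (mul_pos (half_pos hy) hz)
      (mul_le_mul_of_nonneg_right hy'.le hz.le)) hz.le
  · filter_upwards [hZ.ae_ne (s / y)] with ω hω
    have hz := hZ.pos ω
    have hne : y * Z ω ≠ s := fun e => hω (by rw [← e]; field_simp)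
    have h1 := continuousAt_optimalValue hp (mul_pos hy hz) hne
    exact continuousAt_const.mul (ContinuousAt.comp (f := fun y => y * Z ω) h1 (by fun_prop))

theorem IsTangentPoint.tendsto_cost (h : IsTangentPoint v₀ a b p s θ)
    (hZ : IsRegularPrice Q mT Z) (hv₀ : 0 < v₀) (hb : 0 < b) (hb1 : b ≠ 1)
    (hp : p ∈ admissibleFees v₀ a b) :
    Tendsto (fun y => ∫ ω, Z ω * optimalValue v₀ a b p s (y * Z ω) ∂Q) atTop (𝓝 0) := by
  have : Tendsto (fun y => ∫ ω, Z ω * optimalValue v₀ a b p s (y * Z ω) ∂Q) atTop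
      (𝓝 (∫ _, (0 : ℝ) ∂Q)) := by
    refine tendsto_integral_filter_of_dominated_convergence
      (fun ω => Z ω * optimalValue v₀ a b p s (1 * Z ω)) ?_ ?_
      (h.integrable_cost hZ hv₀ hb hb1 hp one_pos) ?_
    · exact Eventually.of_forall fun y' =>
        (hZ.measurable.mul (hZ.measurable_optimalValue y')).aestronglyMeasurable
    · filter_upwards [eventually_ge_atTop 1] with y' hy'
      refine ae_of_all _ fun ω => ?_
      have hz := hZ.pos ω
      have hq := mul_pos (one_pos.trans_le hy') hz
      rw [Real.norm_of_nonneg (mul_nonneg hz.le (h.optimalValue_nonneg hv₀ hb hp hq))]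
      exact mul_le_mul_of_nonneg_left (h.optimalValue_anti hv₀ hb hp (mul_pos one_pos hz)
        (mul_le_mul_of_nonneg_right hy' hz.le)) hz.le
    · refine ae_of_all _ fun ω => ?_
      have hz := hZ.pos ω
      -- For fixed ω the integrand is exactly zero once y Z(ω) > s.
      refine tendsto_const_nhds.congr' ?_
      filter_upwards [eventually_gt_atTop (s / Z ω)] with y hy
      rw [optimalValue, if_neg (by rw [not_le]; exact (div_lt_iff₀ hz).1 hy), mul_zero]
  simpa using this

theorem IsTangentPoint.exists_cost_ge (h : IsTangentPoint v₀ a b p s θ)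
    (hZ : IsRegularPrice Q mT Z) (hv₀ : 0 < v₀) (hb : 0 < b) (hb1 : b ≠ 1)
    (hp : p ∈ admissibleFees v₀ a b) (N : ℝ) :
    ∃ y₀ > 0, N ≤ ∫ ω, Z ω * optimalValue v₀ a b p s (y₀ * Z ω) ∂Q := by
  obtain ⟨hα, hα1⟩ := hp.2.1
  set c := ∫ ω in {ω | Z ω < 1}, Z ω ∂Q with hc
  have hc0 : 0 < c := hZ.setIntegral_pos
  -- On {Z < 1}, where Z has integral c > 0, the price stays below the multiplier; a value of at
  -- least N / c there already costs N.
  obtain ⟨q₀, hq₀, hN⟩ := exists_demand_ge ((1 + p.m) * v₀) (N / c) hα hα1 hb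
    (kinkValue_nonneg hv₀ hb1 hp)
  have hy : 0 < min q₀ s := lt_min hq₀ h.slope_pos
  refine ⟨min q₀ s, hy, ?_⟩
  have hms : MeasurableSet {ω | Z ω < 1} := measurableSet_lt hZ.measurable measurable_const
  have hint := h.integrable_cost hZ hv₀ hb hb1 hp hy
  calc N = ∫ ω in {ω | Z ω < 1}, Z ω * (N / c) ∂Q := by
        rw [integral_mul_const, ← hc]; field_simp
    _ ≤ ∫ ω in {ω | Z ω < 1}, Z ω * optimalValue v₀ a b p s (min q₀ s * Z ω) ∂Q := by
        refine setIntegral_mono_on (hZ.integrable.mul_const _).integrableOn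
          hint.integrableOn hms fun ω hω => ?_
        have hz := hZ.pos ω
        have hle : min q₀ s * Z ω ≤ min q₀ s := mul_le_of_le_one_right hy.le (le_of_lt hω)
        rw [optimalValue, if_pos (hle.trans (min_le_right _ _))]
        exact mul_le_mul_of_nonneg_left
          (hN _ (mul_pos hy hz) (hle.trans (min_le_left _ _))) hz.le
    _ ≤ ∫ ω, Z ω * optimalValue v₀ a b p s (min q₀ s * Z ω) ∂Q :=
        setIntegral_le_integral hint (ae_of_all _ fun ω => mul_nonneg (hZ.pos ω).le
          (h.optimalValue_nonneg hv₀ hb hp (mul_pos hy (hZ.pos ω))))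

theorem IsTangentPoint.exists_cost_eq (h : IsTangentPoint v₀ a b p s θ)
    (hZ : IsRegularPrice Q mT Z) (hv₀ : 0 < v₀) (hb : 0 < b) (hb1 : b ≠ 1)
    (hp : p ∈ admissibleFees v₀ a b) :
    ∃ y > 0, ∫ ω, Z ω * optimalValue v₀ a b p s (y * Z ω) ∂Q = v₀ := by
  obtain ⟨y₀, hy₀, h0⟩ := h.exists_cost_ge hZ hv₀ hb hb1 hp v₀
  obtain ⟨y₁, h1, hy₁⟩ := (((h.tendsto_cost hZ hv₀ hb hb1 hp).eventually_le_const hv₀).and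
    (eventually_ge_atTop y₀)).exists
  obtain ⟨y, hy, e⟩ := intermediate_value_Icc' hy₁ (fun y hy =>
    (h.continuousAt_cost hZ hv₀ hb hb1 hp (hy₀.trans_le hy.1)).continuousWithinAt)
    (show v₀ ∈ _ from ⟨h1, h0⟩)
  exact ⟨y, hy₀.trans_le hy.1, e⟩

/-- Equal costs would force equal values almost surely, but demand is strictly decreasing on the
event that Z is small, which has positive probability. -/
theorem IsTangentPoint.cost_strictAnti (h : IsTangentPoint v₀ a b p s θ)
    (hZ : IsRegularPrice Q mT Z) (hv₀ : 0 < v₀) (hb : 0 < b) (hb1 : b ≠ 1)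
    (hp : p ∈ admissibleFees v₀ a b) {y y' : ℝ} (hy : 0 < y) (hlt : y < y') :
    ∫ ω, Z ω * optimalValue v₀ a b p s (y' * Z ω) ∂Q <
      ∫ ω, Z ω * optimalValue v₀ a b p s (y * Z ω) ∂Q := by
  obtain ⟨hα, hα1⟩ := hp.2.1
  have hk := kinkValue_nonneg hv₀ hb1 hp
  have hy' := hy.trans hlt
  have i1 := h.integrable_cost hZ hv₀ hb hb1 hp hy
  have i2 := h.integrable_cost hZ hv₀ hb hb1 hp hy'
  have hle : ∀ ω, Z ω * optimalValue v₀ a b p s (y' * Z ω) ≤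
      Z ω * optimalValue v₀ a b p s (y * Z ω) := fun ω =>
    mul_le_mul_of_nonneg_left (h.optimalValue_anti hv₀ hb hp (mul_pos hy (hZ.pos ω))
      (mul_le_mul_of_nonneg_right hlt.le (hZ.pos ω).le)) (hZ.pos ω).le
  refine lt_of_le_of_ne (integral_mono i2 i1 hle) fun e => ?_
  have hae := (integral_eq_iff_of_ae_le i2 i1 (ae_of_all _ hle)).1 e
  have hq₀ : 0 < min s (p.α * (p.m * v₀ + a + 1) ^ (-b)) :=
    lt_min h.slope_pos (mul_pos hα (Real.rpow_pos_of_pos (by linarith) _))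
  refine hZ.small _ (div_pos hq₀ hy') (measure_mono_null ?_ (ae_iff.1 hae))
  intro ω hω
  have hz := hZ.pos ω
  have h1 : y' * Z ω < min s (p.α * (p.m * v₀ + a + 1) ^ (-b)) := by
    have := (lt_div_iff₀ hy').1 hω
    linarith
  obtain ⟨h2, h3⟩ := lt_min_iff.1 h1
  have h4 : y * Z ω < y' * Z ω := mul_lt_mul_of_pos_right hlt hz
  have := demand_strictAnti (K := (1 + p.m) * v₀) hα hα1 hb hk (mul_pos hy hz) h4 h3.le
  intro e
  beta_reduce at e
  rw [optimalValue, optimalValue, if_pos h2.le, if_pos (h4.trans h2).le] at e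
  exact this.ne (mul_left_cancel₀ hz.ne' e)

variable [IsProbabilityMeasure Q]

theorem IsTangentPoint.integrable_optimalValue (h : IsTangentPoint v₀ a b p s θ)
    (hZ : IsRegularPrice Q mT Z) (hv₀ : 0 < v₀) (hb : 0 < b) (hb1 : b ≠ 1)
    (hp : p ∈ admissibleFees v₀ a b) {y : ℝ} (hy : 0 < y) :
    Integrable (fun ω => optimalValue v₀ a b p s (y * Z ω)) Q := by
  refine Integrable.mono' (g := fun ω => (1 + p.m) * v₀ + p.α⁻¹ * (y ^ (-1 / b) * Z ω ^ (-1 / b)))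
    ((integrable_const _).add (((hZ.integrable_rpow _).const_mul _).const_mul _))
    (hZ.measurable_optimalValue y).aestronglyMeasurable (ae_of_all _ fun ω => ?_)
  have hq := mul_pos hy (hZ.pos ω)
  rw [Real.norm_of_nonneg (h.optimalValue_nonneg hv₀ hb hp hq),
    ← Real.mul_rpow hy.le (hZ.pos ω).le]
  exact optimalValue_le hv₀ hb hb1 hp hq

/-- The pointwise optimal value, at the multiplier for which the budget binds, solves the
expected utility problem. -/
theorem IsTangentPoint.isSolvedBy (h : IsTangentPoint v₀ a b p s θ)
    (hZ : IsRegularPrice Q mT Z) (hv₀ : 0 < v₀) (hb : 0 < b) (hb1 : b ≠ 1)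
    (hp : p ∈ admissibleFees v₀ a b) {v : ℝ → ℝ → ℝ}
    (hv : ∀ y z : ℝ, 0 < y → 0 < z → v y z = optimalValue v₀ a b p s (y * z)) :
    IsSolvedBy Q mT Z v₀ (managerUtility v₀ a b p) v := by
  have hvZ : ∀ y : ℝ, 0 < y → ∀ ω, v y (Z ω) = optimalValue v₀ a b p s (y * Z ω) :=
    fun y hy ω => hv y (Z ω) hy (hZ.pos ω)
  have hcost : ∀ y : ℝ, 0 < y → ∫ ω, Z ω * v y (Z ω) ∂Q =
      ∫ ω, Z ω * optimalValue v₀ a b p s (y * Z ω) ∂Q := fun y hy => by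
    simp only [hvZ y hy]
  obtain ⟨y, hy, ey⟩ := h.exists_cost_eq hZ hv₀ hb hb1 hp
  set X : Ω → ℝ := fun ω => optimalValue v₀ a b p s (y * Z ω) with hX
  have hvX : (fun ω => v y (Z ω)) = X := funext (hvZ y hy)
  have iX : Integrable X Q := h.integrable_optimalValue hZ hv₀ hb hb1 hp hy
  have iZX : Integrable (fun ω => Z ω * X ω) Q := h.integrable_cost hZ hv₀ hb hb1 hp hy
  have hX0 : ∀ ω, 0 ≤ X ω := fun ω => h.optimalValue_nonneg hv₀ hb hp (mul_pos hy (hZ.pos ω))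
  have hmX : Measurable[mT] X := FirstLoss.measurable_optimalValue.comp (hZ.meas.const_mul y)
  -- Utility is trapped between the constant U(0) and the integrable B.
  have bound : ∀ (V B : Ω → ℝ), Measurable[mT] V → Integrable B Q →
      (∀ᵐ ω ∂Q, managerUtility v₀ a b p (V ω) ≤ B ω) →
      Integrable (fun ω => managerUtility v₀ a b p (V ω)) Q := by
    intro V B hV hB hle
    have hm : Measurable (fun ω => managerUtility v₀ a b p (V ω)) :=
      measurable_utility.comp (hV.mono hZ.le le_rfl)
    refine Integrable.mono' (hB.norm.add (integrable_const |managerUtility v₀ a b p 0|))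
      hm.aestronglyMeasurable ?_
    filter_upwards [hle] with ω hω
    have h1 := utility_zero_le hv₀ hb hb1 hp (V ω)
    simp only [Pi.add_apply]
    rw [Real.norm_eq_abs, Real.norm_eq_abs, abs_le]
    constructor
    · linarith [neg_abs_le (managerUtility v₀ a b p 0), abs_nonneg (B ω)]
    · linarith [le_abs_self (B ω), abs_nonneg (managerUtility v₀ a b p 0)]
  have iU : Integrable (fun ω => managerUtility v₀ a b p (X ω)) Q :=
    bound X (fun ω => managerUtility v₀ a b p 0 + s * X ω) hmX
      ((integrable_const _).add (iX.const_mul s))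
      (ae_of_all _ fun ω => h.utility_le hv₀ hb hb1 hp (hX0 ω))
  have hle : ∀ V : Ω → ℝ, IsFeasible Q mT Z v₀ V → ∀ᵐ ω ∂Q,
      managerUtility v₀ a b p (V ω) - y * (Z ω * V ω) ≤
        managerUtility v₀ a b p (X ω) - y * (Z ω * X ω) := by
    intro V hV
    filter_upwards [hV.2.1] with ω hω
    have := h.le_optimalValue hv₀ hb hb1 hp (mul_pos hy (hZ.pos ω)) hω
    rw [← mul_assoc, ← mul_assoc]
    exact this
  have iV : ∀ V : Ω → ℝ, IsFeasible Q mT Z v₀ V →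
      Integrable (fun ω => managerUtility v₀ a b p (V ω)) Q := by
    intro V hV
    -- The pointwise duality inequality itself supplies the upper bound, integrable because V has
    -- finite cost.
    refine bound V (fun ω => managerUtility v₀ a b p (X ω) - y * (Z ω * X ω) + y * (Z ω * V ω))
      hV.1 ((iU.sub (iZX.const_mul y)).add (hV.2.2.1.const_mul y)) ?_
    filter_upwards [hle V hV] with ω hω
    linarith
  have eX : ∫ ω, (managerUtility v₀ a b p (X ω) - y * (Z ω * X ω)) ∂Q =
      ∫ ω, managerUtility v₀ a b p (X ω) ∂Q - y * v₀ := by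
    rw [integral_sub iU (iZX.const_mul y), integral_const_mul, ey]
  have eV : ∀ V : Ω → ℝ, IsFeasible Q mT Z v₀ V →
      ∫ ω, managerUtility v₀ a b p (V ω) ∂Q - y * v₀ ≤
        ∫ ω, (managerUtility v₀ a b p (V ω) - y * (Z ω * V ω)) ∂Q := by
    intro V hV
    rw [integral_sub (iV V hV) (hV.2.2.1.const_mul y), integral_const_mul]
    have := mul_le_mul_of_nonneg_left hV.2.2.2 hy.le
    linarith
  have hfeas : IsFeasible Q mT Z v₀ X := ⟨hmX, ae_of_all _ hX0, iZX, ey.le⟩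
  refine ⟨fun y' hy' => ?_, y, hy, (hcost y hy).trans ey, ?_, ?_, ?_⟩
  · simp only [hvZ y' hy']
    exact h.integrable_cost hZ hv₀ hb hb1 hp hy'
  · intro y' hy' e
    rw [hcost y' hy'] at e
    rcases lt_trichotomy y' y with h1 | h1 | h1
    · have := h.cost_strictAnti hZ hv₀ hb hb1 hp hy' h1
      rw [e, ey] at this
      exact absurd this (lt_irrefl _)
    · exact h1
    · have := h.cost_strictAnti hZ hv₀ hb hb1 hp hy h1
      rw [e, ey] at this
      exact absurd this (lt_irrefl _)
  · rw [hvX]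
    refine ⟨hfeas, iU, fun V hV => ⟨iV V hV, ?_⟩⟩
    have h1 := integral_mono_ae ((iV V hV).sub (hV.2.2.1.const_mul y))
      (iU.sub (iZX.const_mul y)) (hle V hV)
    have h2 := eV V hV
    simp only [Pi.sub_apply] at h1
    rw [eX] at h1
    linarith
  · intro V hV
    rw [hvX]
    have hmax := (hV.2.2 X hfeas).2
    have h2 := eV V hV.1
    have iV' := (iV V hV.1).sub (hV.1.2.2.1.const_mul y)
    have iX' := iU.sub (iZX.const_mul y)
    have h1 := integral_mono_ae iV' iX' (hle V hV.1)
    simp only [Pi.sub_apply] at h1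
    -- An optimal V attains the pointwise bound in integral, hence almost surely; away from the null
    -- event y Z = s the bound is strict unless V = X.
    have he : ∫ ω, (managerUtility v₀ a b p (V ω) - y * (Z ω * V ω)) ∂Q =
        ∫ ω, (managerUtility v₀ a b p (X ω) - y * (Z ω * X ω)) ∂Q :=
      le_antisymm h1 (by rw [eX]; linarith)
    filter_upwards [(integral_eq_iff_of_ae_le iV' iX' (hle V hV.1)).1 he, hV.1.2.1,
      hZ.ae_ne (s / y)] with ω hω hω0 hωs
    by_contra hne
    have hz := hZ.pos ω
    have hqs : y * Z ω ≠ s := fun e => hωs (by rw [← e]; field_simp)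
    have := h.lt_optimalValue hv₀ hb hb1 hp (mul_pos hy hz) hqs hω0 hne
    rw [mul_assoc, mul_assoc] at this
    exact this.ne hω

end Problem

/-! ### The Black-Scholes state price density -/

/-- The log-price is affine in a Gaussian of variance T > 0 with slope -γ ≠ 0. Gaussian exponential
moments give the powers; absence of atoms and full support of the law give the rest. -/
theorem isRegularPrice_statePriceDensity {Ω : Type*} {mΩ : MeasurableSpace Ω} {Q : Measure Ω}
    [IsProbabilityMeasure Q] {T : ℝ} (hT : 0 < T)
    {ℱ : Filtration (Set.Icc (0 : ℝ) T) mΩ} {W : Set.Icc (0 : ℝ) T → Ω → ℝ}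
    (hW : IsWienerProcess W ℱ Q) {r μ σ : ℝ} (hσ : 0 < σ) (hμr : μ ≠ r) :
    IsRegularPrice Q (ℱ (terminal hT)) (statePriceDensity r μ σ W (terminal hT)) := by
  set γ := σ⁻¹ * (μ - r) with hγ
  have hγ0 : γ ≠ 0 := mul_ne_zero (inv_pos.2 hσ).ne' (sub_ne_zero.2 hμr)
  set X : Ω → ℝ := W (terminal hT) with hX
  set d : ℝ := -(r + (1 / 2) * γ ^ 2) * T with hd
  have hZ : statePriceDensity r μ σ W (terminal hT) = fun ω => Real.exp (d - γ * X ω) := rfl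
  have hXm' : Measurable[ℱ (terminal hT)] X := hW.adapted _
  have hXm : Measurable X := hXm'.mono (ℱ.le _) le_rfl
  have hv : Real.toNNReal T ≠ 0 := (Real.toNNReal_pos.2 hT).ne'
  have hlaw : Q.map X = gaussianReal 0 (Real.toNNReal T) := by
    have h0 : (0 : ℝ) ∈ Set.Icc (0 : ℝ) T := ⟨le_rfl, hT.le⟩
    have h1 := hW.gaussian_increments ⟨0, h0⟩ (terminal hT) hT.le
    have h2 : (fun ω => W (terminal hT) ω - W ⟨0, h0⟩ ω) =ᵐ[Q] X := by
      filter_upwards [hW.start_zero ⟨0, h0⟩ rfl] with ω hω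
      rw [hω, sub_zero]
    rw [Measure.map_congr h2] at h1
    rw [h1]
    simp [terminal]
  rw [hZ]
  refine ⟨ℱ.le _, ?_, fun ω => Real.exp_pos _, ?_, ?_, ?_⟩
  · exact Real.measurable_exp.comp ((hXm'.const_mul γ).const_sub d)
  · intro ρ
    have h1 := integrable_exp_mul_gaussianReal (μ := 0) (v := Real.toNNReal T) (-γ * ρ)
    rw [← hlaw] at h1
    have h2 := (h1.comp_measurable hXm).const_mul (Real.exp (d * ρ))
    refine h2.congr (ae_of_all _ fun ω => ?_)
    simp only [Function.comp_apply]
    rw [← Real.exp_mul, ← Real.exp_add]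
    congr 1; ring
  · intro c
    have h1 : (Q.map X) {(d - Real.log c) / γ} = 0 := by
      rw [hlaw]
      have := nullSingletonClass_gaussianReal (μ := 0) hv
      exact measure_singleton _
    rw [Measure.map_apply hXm (measurableSet_singleton _)] at h1
    refine ae_iff.2 (measure_mono_null ?_ h1)
    intro ω hω
    have hω' : Real.exp (d - γ * X ω) = c := not_not.1 hω
    show X ω = (d - Real.log c) / γ
    rw [← hω', Real.log_exp]
    field_simp; ring
  · intro ε hε h0
    have hS : IsOpen {x : ℝ | Real.exp (d - γ * x) < ε} :=
      isOpen_lt (by fun_prop) continuous_const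
    have h1 : (Q.map X) {x : ℝ | Real.exp (d - γ * x) < ε} = 0 := by
      rw [Measure.map_apply hXm hS.measurableSet]; exact h0
    rw [hlaw] at h1
    -- The witness is the point where the log-price equals log ε - 1.
    refine (hS.measure_pos volume ⟨(d - (Real.log ε - 1)) / γ, ?_⟩).ne'
      (gaussianReal_absolutelyContinuous' 0 hv h1)
    show Real.exp (d - γ * ((d - (Real.log ε - 1)) / γ)) < ε
    rw [mul_div_cancel₀ _ hγ0, sub_sub_cancel, ← Real.lt_log_iff_exp_lt hε]
    linarith

/-! ### The three regions -/

section Regions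

variable {v₀ a b : ℝ} {p : FeeStructure}

theorem kinkMarginal_of_pos (hk : 0 < p.m * v₀ + a) :
    kinkMarginal v₀ a b p = (((p.m * v₀ + a) ^ (-b) : ℝ) : EReal) := by
  rw [kinkMarginal, ENNReal.ofReal_rpow_of_pos hk, EReal.coe_ennreal_ofReal,
    max_eq_left (Real.rpow_nonneg hk.le _)]

theorem kinkMarginal_of_eq_zero (hb : 0 < b) (hk : p.m * v₀ + a = 0) :
    kinkMarginal v₀ a b p = ⊤ := by
  rw [kinkMarginal, hk, ENNReal.ofReal_zero, ENNReal.zero_rpow_of_neg (by linarith)]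
  rfl

theorem mul_kinkMarginal_le (hv₀ : 0 < v₀) (hb : 0 < b) (hb1 : b ≠ 1)
    (hp : p ∈ admissibleFees v₀ a b) :
    (p.α : EReal) * kinkMarginal v₀ a b p ≤ kinkMarginal v₀ a b p := by
  rcases (kinkValue_nonneg hv₀ hb1 hp).eq_or_lt with hk | hk
  · rw [kinkMarginal_of_eq_zero hb hk.symm]
    exact le_top
  · rw [kinkMarginal_of_pos hk, ← EReal.coe_mul, EReal.coe_le_coe_iff]
    exact mul_le_of_le_one_left (Real.rpow_nonneg hk.le _) hp.2.1.2

theorem regions_partition (hv₀ : 0 < v₀) (hb : 0 < b) (hb1 : b ≠ 1) :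
    regionA v₀ a b ∪ regionB v₀ a b ∪ regionC v₀ a b = admissibleFees v₀ a b ∧
      Disjoint (regionA v₀ a b) (regionB v₀ a b) ∧
      Disjoint (regionA v₀ a b) (regionC v₀ a b) ∧
      Disjoint (regionB v₀ a b) (regionC v₀ a b) := by
  refine ⟨?_, ?_, ?_, ?_⟩
  · ext p
    constructor
    · rintro ((h | h) | h) <;> exact h.1
    · intro hp
      rcases lt_or_ge (thresholdH v₀ a b p : EReal) (p.α * kinkMarginal v₀ a b p) with h | h
      · exact Or.inl (Or.inl ⟨hp, h⟩)
      rcases le_or_gt (thresholdH v₀ a b p : EReal) (kinkMarginal v₀ a b p) with h' | h'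
      · exact Or.inl (Or.inr ⟨hp, h, h'⟩)
      · exact Or.inr ⟨hp, h'⟩
  · exact Set.disjoint_left.2 fun p h h' => h.2.not_ge h'.2.1
  · exact Set.disjoint_left.2 fun p h h' =>
      (h.2.trans_le (mul_kinkMarginal_le hv₀ hb hb1 h.1)).not_gt h'.2
  · exact Set.disjoint_left.2 fun p h h' => h.2.2.not_gt h'.2

/-- Identifies H as the slope of the chord of U from 0 to the kink. -/
theorem thresholdH_mul (hv₀ : 0 < v₀) (hb1 : b ≠ 1) (hp : p ∈ admissibleFees v₀ a b) :
    thresholdH v₀ a b p * ((1 + p.m) * v₀) = 1 / (1 - b) * (p.m * v₀ + a) ^ (1 - b) -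
      1 / (1 - b) * (v₀ * (p.m - p.c) + a) ^ (1 - b) := by
  have h1 : 1 - b ≠ 0 := sub_ne_zero.2 hb1.symm
  have h2 : 1 + p.m ≠ 0 := by have := hp.1.1; positivity
  have h3 := hv₀.ne'
  rw [thresholdH]
  field_simp

theorem utility_kink (hv₀ : 0 < v₀) (hp : p ∈ admissibleFees v₀ a b) :
    managerUtility v₀ a b p ((1 + p.m) * v₀) = 1 / (1 - b) * (p.m * v₀ + a) ^ (1 - b) := by
  rw [managerUtility, hara, payoff_upper hv₀ hp le_rfl, sub_self, mul_zero, add_zero]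

/-- A vanishing kink value has infinite marginal utility, which the finite H cannot reach: such fees
belong to region A. -/
theorem kinkValue_pos_of_regionB (hv₀ : 0 < v₀) (hb : 0 < b) (hb1 : b ≠ 1)
    (h : p ∈ regionB v₀ a b) : 0 < p.m * v₀ + a := by
  refine lt_of_le_of_ne (kinkValue_nonneg hv₀ hb1 h.1) fun hk => ?_
  have h2 := h.2.1
  rw [kinkMarginal_of_eq_zero hb hk.symm, EReal.coe_mul_top_of_pos h.1.2.1.1, top_le_iff] at h2
  exact EReal.coe_ne_top _ h2

theorem kinkValue_pos_of_regionC (hv₀ : 0 < v₀) (hb : 0 < b) (hb1 : b ≠ 1)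
    (h : p ∈ regionC v₀ a b) : 0 < p.m * v₀ + a := by
  refine lt_of_le_of_ne (kinkValue_nonneg hv₀ hb1 h.1) fun hk => ?_
  have h2 := h.2
  rw [kinkMarginal_of_eq_zero hb hk.symm] at h2
  exact not_top_lt h2

theorem upperPiece_eq {y z : ℝ} (hα : 0 < p.α) (hy : 0 < y) (hz : 0 < z) :
    upperPiece v₀ a b p y z = (1 + p.m) * v₀ +
      p.α⁻¹ * ((y * z / p.α) ^ (-1 / b) - (p.m * v₀ + a)) := by
  have h1 : p.α ^ (1 / b - 1) * (y * z) ^ (-1 / b) = p.α⁻¹ * (y * z / p.α) ^ (-1 / b) := by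
    rw [Real.div_rpow (mul_pos hy hz).le hα.le, Real.rpow_sub_one hα.ne', neg_div,
      Real.rpow_neg hα.le]
    field_simp
  rw [upperPiece, h1]
  ring

/-! ### Case A -/

/-- In the coordinate x = k + α(v - K) the upper branch is pure power utility, x + D = α v with D =
αK - k, and v = 0 becomes x = -D. H < α k^(-b) says that the tangent at the kink passes below (-D,
U(0)); far tangents pass above. -/
theorem exists_tangent_regionA (hv₀ : 0 < v₀) (hb : 0 < b) (hb1 : b ≠ 1)
    (h : p ∈ regionA v₀ a b) : ∃ x, p.m * v₀ + a < x ∧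
      1 / (1 - b) * x ^ (1 - b) - 1 / (1 - b) * (v₀ * (p.m - p.c) + a) ^ (1 - b) =
        x ^ (-b) * (x + (p.α * ((1 + p.m) * v₀) - (p.m * v₀ + a))) := by
  have hp := h.1
  have hα := hp.2.1.1
  have hK := kink_pos hv₀ hp
  have hw := floor_nonneg hb1 hp
  obtain ⟨x₀, hkx, hx₀, hg⟩ : ∃ x₀, p.m * v₀ + a ≤ x₀ ∧ 0 < x₀ ∧
      1 / (1 - b) * x₀ ^ (1 - b) - 1 / (1 - b) * (v₀ * (p.m - p.c) + a) ^ (1 - b) <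
        x₀ ^ (-b) * (x₀ + (p.α * ((1 + p.m) * v₀) - (p.m * v₀ + a))) := by
    -- If k = 0 there is no tangent at the kink. Then the floor is also 0, hence b < 1, and a small
    -- positive x replaces the kink.
    rcases (kinkValue_nonneg hv₀ hb1 hp).eq_or_lt with hk | hk
    · have hw0 : v₀ * (p.m - p.c) + a = 0 := le_antisymm
        ((floor_le_kinkValue hv₀ hp).trans hk.symm.le) hw
      have hb2 : b < 1 := by
        refine lt_of_le_of_ne (not_lt.1 fun hb2 => ?_) hb1
        exact (floor_pos hb2 hp).ne' hw0
      obtain ⟨x, hx, -, hlt⟩ := exists_tangent_gap_pos hb2 (mul_pos hα hK) one_pos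
      refine ⟨x, by rw [← hk]; exact hx.le, hx, ?_⟩
      rw [hw0, Real.zero_rpow (by linarith), mul_zero, sub_zero, ← hk, sub_zero]
      exact hlt
    · refine ⟨_, le_rfl, hk, ?_⟩
      have h2 := h.2
      rw [kinkMarginal_of_pos hk, ← EReal.coe_mul, EReal.coe_lt_coe_iff] at h2
      rw [← thresholdH_mul hv₀ hb1 hp, add_sub_cancel]
      have := mul_lt_mul_of_pos_right h2 hK
      linarith
  obtain ⟨x₁, hx₁, hx₁0, hg₁⟩ := exists_tangent_gap_neg (w := v₀ * (p.m - p.c) + a)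
    (p.α * ((1 + p.m) * v₀) - (p.m * v₀ + a)) x₀ hb hb1 (fun hb2 => floor_pos hb2 hp)
  obtain ⟨x, hx, e⟩ := exists_tangent hx₀ hg hg₁ hx₁
  exact ⟨x, hkx.trans_lt hx.1, e⟩

theorem equationA_iff (hb1 : b ≠ 1) {v x : ℝ} (hx0 : 0 < x)
    (hx : x = p.m * v₀ + a + p.α * (v - (1 + p.m) * v₀)) :
    EquationA v₀ a b p v ↔
      1 / (1 - b) * x ^ (1 - b) - 1 / (1 - b) * (v₀ * (p.m - p.c) + a) ^ (1 - b) =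
        x ^ (-b) * (x + (p.α * ((1 + p.m) * v₀) - (p.m * v₀ + a))) := by
  rw [← tangent_iff hb1 hx0, EquationA]
  have e1 : p.α * v + (p.m - p.α * (1 + p.m)) * v₀ + a = x := by rw [hx]; ring
  have e2 : b * p.α * v + (p.m - p.α * (1 + p.m)) * v₀ + a =
      b * (x + (p.α * ((1 + p.m) * v₀) - (p.m * v₀ + a))) -
        (p.α * ((1 + p.m) * v₀) - (p.m * v₀ + a)) := by rw [hx]; ring
  rw [e1, e2]

theorem valueA_eq {x y z : ℝ} (hb : 0 < b) (hp : p ∈ admissibleFees v₀ a b) (hx0 : 0 < x)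
    (hx : p.m * v₀ + a < x) (hy : 0 < y) (hz : 0 < z) :
    valueA v₀ a b p (p.α * x ^ (-b)) y z = optimalValue v₀ a b p (p.α * x ^ (-b)) (y * z) := by
  obtain ⟨hα, hα1⟩ := hp.2.1
  have hq := mul_pos hy hz
  rw [valueA, optimalValue, Set.indicator_apply]
  have hmem : z ∈ Set.Ioc 0 (p.α * x ^ (-b) / y) ↔ y * z ≤ p.α * x ^ (-b) := by
    rw [Set.mem_Ioc, le_div_iff₀' hy]; exact and_iff_right hz
  by_cases hle : y * z ≤ p.α * x ^ (-b)
  · rw [if_pos (hmem.2 hle), if_pos hle, upperPiece_eq hα hy hz, demand_of_upper hα hα1 hb hq]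
    have := rpow_neg_inv_anti_le hb (div_pos hq hα) ((div_le_iff₀' hα).2 hle)
    rw [rpow_neg_rpow_neg_inv hb hx0] at this
    linarith
  · rw [if_neg (hmem.not.2 hle), if_neg hle]

theorem caseA {Ω : Type*} {mT : MeasurableSpace Ω} {mΩ : MeasurableSpace Ω} {Q : Measure Ω}
    [IsProbabilityMeasure Q] {Z : Ω → ℝ} (hZ : IsRegularPrice Q mT Z) (hv₀ : 0 < v₀)
    (hb : 0 < b) (hb1 : b ≠ 1) (h : p ∈ regionA v₀ a b) :
    ∃ θ : ℝ, (θ ∈ Set.Ioi ((1 + p.m) * v₀) ∧ EquationA v₀ a b p θ) ∧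
      (∀ v ∈ Set.Ioi ((1 + p.m) * v₀), EquationA v₀ a b p v → v = θ) ∧
      (∀ v : ℝ, IsConcavificationPoint v₀ a b p v ↔ v = θ) ∧
      chordSlope (managerUtility v₀ a b p) θ
        = p.α * (p.α * θ + (p.m - p.α * (1 + p.m)) * v₀ + a) ^ (-b) ∧
      IsSolvedBy Q mT Z v₀ (managerUtility v₀ a b p)
        (valueA v₀ a b p (chordSlope (managerUtility v₀ a b p) θ)) := by
  have hp := h.1
  obtain ⟨hα, hα1⟩ := hp.2.1
  have hk := kinkValue_nonneg hv₀ hb1 hp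
  have hK := kink_pos hv₀ hp
  obtain ⟨x, hkx, e⟩ := exists_tangent_regionA hv₀ hb hb1 h
  have hx0 : 0 < x := hk.trans_lt hkx
  obtain ⟨θ, hθ⟩ : ∃ θ, θ = (1 + p.m) * v₀ + p.α⁻¹ * (x - (p.m * v₀ + a)) := ⟨_, rfl⟩
  have hθK : (1 + p.m) * v₀ < θ := by
    have := mul_pos (inv_pos.2 hα) (sub_pos.2 hkx)
    linarith
  have hxθ : x = p.m * v₀ + a + p.α * (θ - (1 + p.m) * v₀) := by
    rw [hθ, add_sub_cancel_left, mul_inv_cancel_left₀ hα.ne']; ring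
  have hxb := Real.rpow_pos_of_pos hx0 (-b)
  have ht : IsTangentPoint v₀ a b p (p.α * x ^ (-b)) θ := by
    refine ⟨(flat_le_kink hv₀ hp).trans hθK.le, mul_pos hα hxb, ?_, ?_⟩
    · rw [utility_zero hv₀ hp, managerUtility, hara, payoff_upper hv₀ hp hθK.le, ← hxθ, e]
      have : x + (p.α * ((1 + p.m) * v₀) - (p.m * v₀ + a)) = p.α * θ := by
        rw [hxθ]; ring
      rw [this]; ring
    · have e1 : (p.α * x ^ (-b) / p.α) ^ (-1 / b) = x := by
        rw [mul_div_cancel_left₀ _ hα.ne', rpow_neg_rpow_neg_inv hb hx0]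
      rw [demand_of_upper hα hα1 hb (mul_pos hα hxb) (by rw [e1]; exact hkx.le), e1, hθ]
  have hs := ht.chordSlope_eq hv₀ hp
  refine ⟨θ, ⟨hθK, (equationA_iff hb1 hx0 hxθ).2 e⟩, ?_,
    ht.isConcavificationPoint_iff hv₀ hb hb1 hp, ?_, ?_⟩
  · intro v hv hE
    have hv' : 0 < p.α * (v - (1 + p.m) * v₀) := mul_pos hα (sub_pos.2 hv)
    have hx' : 0 < p.m * v₀ + a + p.α * (v - (1 + p.m) * v₀) := by linarith
    have e' := (equationA_iff hb1 hx' rfl).1 hE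
    have hαK := mul_pos hα hK
    have := tangent_unique hb hb1 hx' hx0 (by linarith) (by linarith) e' e
    rw [hxθ] at this
    have := mul_left_cancel₀ hα.ne' (add_left_cancel this)
    linarith
  · rw [hs]
    congr 2
    rw [hxθ]; ring
  · rw [hs]
    exact ht.isSolvedBy hZ hv₀ hb hb1 hp fun y z hy hz => valueA_eq hb hp hx0 hkx hy hz

/-! ### Case B -/

theorem mem_Ioo_div_iff {y z A : ℝ} (hy : 0 < y) (hz : 0 < z) :
    z ∈ Set.Ioo 0 (A / y) ↔ y * z < A := by
  rw [Set.mem_Ioo, lt_div_iff₀' hy]; exact and_iff_right hz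

theorem mem_Icc_div_iff {y z A B : ℝ} (hy : 0 < y) :
    z ∈ Set.Icc (A / y) (B / y) ↔ A ≤ y * z ∧ y * z ≤ B := by
  rw [Set.mem_Icc, le_div_iff₀' hy, div_le_iff₀' hy]

theorem mem_Ioc_div_iff {y z A B : ℝ} (hy : 0 < y) :
    z ∈ Set.Ioc (A / y) (B / y) ↔ A < y * z ∧ y * z ≤ B := by
  rw [Set.mem_Ioc, le_div_iff₀' hy, div_lt_iff₀' hy]

theorem lt_upper_iff {q : ℝ} (hb : 0 < b) (hα : 0 < p.α) (hk : 0 < p.m * v₀ + a) (hq : 0 < q) :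
    p.m * v₀ + a < (q / p.α) ^ (-1 / b) ↔ q < p.α * (p.m * v₀ + a) ^ (-b) := by
  rw [lt_rpow_neg_inv_iff hb (div_pos hq hα) hk, div_lt_iff₀' hα]

theorem le_lower_iff {q : ℝ} (hb : 0 < b) (hk : 0 < p.m * v₀ + a) (hq : 0 < q) :
    p.m * v₀ + a ≤ q ^ (-1 / b) ↔ q ≤ (p.m * v₀ + a) ^ (-b) := by
  constructor
  · intro h
    have := Real.rpow_le_rpow_of_nonpos hk h (neg_nonpos.2 hb.le)
    rwa [rpow_neg_inv_rpow_neg hb hq] at this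
  · intro h
    have := rpow_neg_inv_anti_le hb hq h
    rwa [rpow_neg_rpow_neg_inv hb hk] at this

theorem valueB_eq {s y z : ℝ} (hb : 0 < b) (hp : p ∈ admissibleFees v₀ a b)
    (hk : 0 < p.m * v₀ + a) (hs : p.α * (p.m * v₀ + a) ^ (-b) ≤ s)
    (hs' : s ≤ (p.m * v₀ + a) ^ (-b)) (hy : 0 < y) (hz : 0 < z) :
    valueB v₀ a b p s y z = optimalValue v₀ a b p s (y * z) := by
  obtain ⟨hα, hα1⟩ := hp.2.1
  have hq := mul_pos hy hz
  rw [valueB, optimalValue, Set.indicator_apply, Set.indicator_apply]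
  simp only [mem_Ioo_div_iff hy hz, mem_Icc_div_iff hy]
  rcases lt_or_ge (y * z) (p.α * (p.m * v₀ + a) ^ (-b)) with h1 | h1
  · rw [if_pos h1, if_neg (fun h => h.1.not_gt h1), if_pos (h1.le.trans hs), add_zero,
      upperPiece_eq hα hy hz, demand_of_upper hα hα1 hb hq ((lt_upper_iff hb hα hk hq).2 h1).le]
  · rw [if_neg h1.not_gt, zero_add]
    by_cases h2 : y * z ≤ s
    · rw [if_pos ⟨h1, h2⟩, if_pos h2, demand_of_middle
        (not_lt.1 ((lt_upper_iff hb hα hk hq).not.2 h1.not_gt))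
        ((le_lower_iff hb hk hq).2 (h2.trans hs'))]
    · rw [if_neg (fun h => h2 h.2), if_neg h2]

/-- H lies between the marginal utilities of the two branches at the kink, so demand at price H is
the kink itself and the chord to it is a supporting line. -/
theorem caseB {Ω : Type*} {mT : MeasurableSpace Ω} {mΩ : MeasurableSpace Ω} {Q : Measure Ω}
    [IsProbabilityMeasure Q] {Z : Ω → ℝ} (hZ : IsRegularPrice Q mT Z) (hv₀ : 0 < v₀)
    (hb : 0 < b) (hb1 : b ≠ 1) (h : p ∈ regionB v₀ a b) :
    (∀ v : ℝ, IsConcavificationPoint v₀ a b p v ↔ v = (1 + p.m) * v₀) ∧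
      chordSlope (managerUtility v₀ a b p) ((1 + p.m) * v₀) = thresholdH v₀ a b p ∧
      IsSolvedBy Q mT Z v₀ (managerUtility v₀ a b p)
        (valueB v₀ a b p (thresholdH v₀ a b p)) := by
  have hp := h.1
  obtain ⟨hα, hα1⟩ := hp.2.1
  have hk := kinkValue_pos_of_regionB hv₀ hb hb1 h
  obtain ⟨h1, h2⟩ := h.2
  rw [kinkMarginal_of_pos hk, ← EReal.coe_mul, EReal.coe_le_coe_iff] at h1
  rw [kinkMarginal_of_pos hk, EReal.coe_le_coe_iff] at h2
  have hs0 : 0 < thresholdH v₀ a b p := (mul_pos hα (Real.rpow_pos_of_pos hk _)).trans_le h1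
  have ht : IsTangentPoint v₀ a b p (thresholdH v₀ a b p) ((1 + p.m) * v₀) := by
    refine ⟨flat_le_kink hv₀ hp, hs0, ?_, ?_⟩
    · rw [thresholdH_mul hv₀ hb1 hp, utility_kink hv₀ hp, utility_zero hv₀ hp]
    · exact demand_of_middle (not_lt.1 ((lt_upper_iff hb hα hk hs0).not.2 h1.not_gt))
        ((le_lower_iff hb hk hs0).2 h2)
  exact ⟨ht.isConcavificationPoint_iff hv₀ hb hb1 hp, ht.chordSlope_eq hv₀ hp,
    ht.isSolvedBy hZ hv₀ hb hb1 hp fun y z hy hz => valueB_eq hb hp hk h1 h2 hy hz⟩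

/-! ### Case C -/

/-- Here x = v - v₀ + a and D = v₀ - a, so x + D = v. H > k^(-b) says that the tangent at the kink
passes above (-D, U(0)), while the tangent at the end of the flat part passes below it. -/
theorem exists_tangent_regionC (hv₀ : 0 < v₀) (hb : 0 < b) (hb1 : b ≠ 1)
    (h : p ∈ regionC v₀ a b) : ∃ x, 0 < x ∧ v₀ * (p.m - p.c) + a < x ∧ x < p.m * v₀ + a ∧
      1 / (1 - b) * x ^ (1 - b) - 1 / (1 - b) * (v₀ * (p.m - p.c) + a) ^ (1 - b) =
        x ^ (-b) * (x + (v₀ - a)) := by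
  have hp := h.1
  have hK := kink_pos hv₀ hp
  have hL := flat_pos hv₀ hp
  have hk := kinkValue_pos_of_regionC hv₀ hb hb1 h
  have hkb := Real.rpow_pos_of_pos hk (-b)
  have h2 := h.2
  rw [kinkMarginal_of_pos hk, EReal.coe_lt_coe_iff] at h2
  have hH := thresholdH_mul hv₀ hb1 hp
  have hg₁ : (p.m * v₀ + a) ^ (-b) * (p.m * v₀ + a + (v₀ - a)) <
      1 / (1 - b) * (p.m * v₀ + a) ^ (1 - b) -
        1 / (1 - b) * (v₀ * (p.m - p.c) + a) ^ (1 - b) := by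
    rw [← hH]
    have := mul_lt_mul_of_pos_right h2 hK
    have e : p.m * v₀ + a + (v₀ - a) = (1 + p.m) * v₀ := by ring
    rwa [e]
  have hwk : v₀ * (p.m - p.c) + a < p.m * v₀ + a := by
    refine lt_of_le_of_ne (floor_le_kinkValue hv₀ hp) fun e => ?_
    rw [e, sub_self] at hH
    exact (mul_pos (hkb.trans h2) hK).ne' hH
  obtain ⟨x₀, hx₀, hwx, hxk, hg⟩ : ∃ x₀, 0 < x₀ ∧ v₀ * (p.m - p.c) + a ≤ x₀ ∧
      x₀ < p.m * v₀ + a ∧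
      1 / (1 - b) * x₀ ^ (1 - b) - 1 / (1 - b) * (v₀ * (p.m - p.c) + a) ^ (1 - b) <
        x₀ ^ (-b) * (x₀ + (v₀ - a)) := by
    -- At x₀ equal to a positive floor the utility gain is zero while x₀ + D is the positive flat
    -- level. A zero floor forces b < 1, and a point near zero is used instead.
    rcases (floor_nonneg hb1 hp).eq_or_lt with hw | hw
    · have hb2 : b < 1 := by
        refine lt_of_le_of_ne (not_lt.1 fun hb2 => ?_) hb1
        exact (floor_pos hb2 hp).ne hw
      obtain ⟨x, hx, hxk, hlt⟩ := exists_tangent_gap_pos (D := v₀ - a) hb2 (by linarith) hk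
      refine ⟨x, hx, by rw [← hw]; exact hx.le, hxk, ?_⟩
      rw [← hw, Real.zero_rpow (by linarith), mul_zero, sub_zero]
      exact hlt
    · refine ⟨_, hw, le_rfl, hwk, ?_⟩
      rw [sub_self]
      exact mul_pos (Real.rpow_pos_of_pos hw _) (by linarith)
  obtain ⟨x, hx, e⟩ := exists_tangent hx₀ hg hg₁ hxk
  exact ⟨x, hx₀.trans hx.1, hwx.trans_lt hx.1, hx.2, e⟩

theorem equationC_iff (hb1 : b ≠ 1) {v x : ℝ} (hx0 : 0 < x) (hx : x = v - v₀ + a) :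
    EquationC v₀ a b p v ↔
      1 / (1 - b) * x ^ (1 - b) - 1 / (1 - b) * (v₀ * (p.m - p.c) + a) ^ (1 - b) =
        x ^ (-b) * (x + (v₀ - a)) := by
  rw [← tangent_iff hb1 hx0, EquationC, ← hx]
  have e : b * v - v₀ + a = b * (x + (v₀ - a)) - (v₀ - a) := by rw [hx]; ring
  rw [e]

theorem valueC_eq {x y z : ℝ} (hb : 0 < b) (hp : p ∈ admissibleFees v₀ a b) (hx0 : 0 < x)
    (hx : x < p.m * v₀ + a) (hy : 0 < y) (hz : 0 < z) :
    valueC v₀ a b p (x ^ (-b)) y z = optimalValue v₀ a b p (x ^ (-b)) (y * z) := by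
  obtain ⟨hα, hα1⟩ := hp.2.1
  have hk := hx0.trans hx
  have hq := mul_pos hy hz
  have hkb := Real.rpow_pos_of_pos hk (-b)
  have h12 : p.α * (p.m * v₀ + a) ^ (-b) ≤ (p.m * v₀ + a) ^ (-b) :=
    mul_le_of_le_one_left hkb.le hα1
  have h23 : (p.m * v₀ + a) ^ (-b) < x ^ (-b) :=
    Real.rpow_lt_rpow_of_neg hx0 hx (by linarith)
  rw [valueC, optimalValue, Set.indicator_apply, Set.indicator_apply, Set.indicator_apply]
  simp only [mem_Ioo_div_iff hy hz, mem_Icc_div_iff hy, mem_Ioc_div_iff hy]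
  rcases lt_or_ge (y * z) (p.α * (p.m * v₀ + a) ^ (-b)) with h1 | h1
  · rw [if_pos h1, if_neg (fun h => h.1.not_gt h1), if_neg (fun h => (h1.trans_le h12).not_gt h.1),
      if_pos ((h1.le.trans h12).trans h23.le), add_zero, add_zero,
      upperPiece_eq hα hy hz, demand_of_upper hα hα1 hb hq ((lt_upper_iff hb hα hk hq).2 h1).le]
  rw [if_neg h1.not_gt, zero_add]
  rcases le_or_gt (y * z) ((p.m * v₀ + a) ^ (-b)) with h2 | h2
  · rw [if_pos ⟨h1, h2⟩, if_neg (fun h => h.1.not_ge h2), if_pos (h2.trans h23.le), add_zero,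
      demand_of_middle (not_lt.1 ((lt_upper_iff hb hα hk hq).not.2 h1.not_gt))
        ((le_lower_iff hb hk hq).2 h2)]
  rw [if_neg (fun h => h.2.not_gt h2), zero_add]
  by_cases h3 : y * z ≤ x ^ (-b)
  · rw [if_pos ⟨h2, h3⟩, if_pos h3, middlePiece,
      demand_of_lower hα hα1 hb hq (not_le.1 ((le_lower_iff hb hk hq).not.2 h2.not_ge)).le]
    ring
  · rw [if_neg (fun h => h3 h.2), if_neg h3]

theorem caseC {Ω : Type*} {mT : MeasurableSpace Ω} {mΩ : MeasurableSpace Ω} {Q : Measure Ω}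
    [IsProbabilityMeasure Q] {Z : Ω → ℝ} (hZ : IsRegularPrice Q mT Z) (hv₀ : 0 < v₀)
    (hb : 0 < b) (hb1 : b ≠ 1) (h : p ∈ regionC v₀ a b) :
    ∃ θ : ℝ, (θ ∈ Set.Ioo ((1 + p.m - p.c) * v₀) ((1 + p.m) * v₀) ∧ EquationC v₀ a b p θ) ∧
      (∀ v ∈ Set.Ioo ((1 + p.m - p.c) * v₀) ((1 + p.m) * v₀),
        EquationC v₀ a b p v → v = θ) ∧
      (∀ v : ℝ, IsConcavificationPoint v₀ a b p v ↔ v = θ) ∧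
      chordSlope (managerUtility v₀ a b p) θ = (θ - v₀ + a) ^ (-b) ∧
      IsSolvedBy Q mT Z v₀ (managerUtility v₀ a b p)
        (valueC v₀ a b p (chordSlope (managerUtility v₀ a b p) θ)) := by
  have hp := h.1
  obtain ⟨hα, hα1⟩ := hp.2.1
  have hL := flat_pos hv₀ hp
  have hw := floor_nonneg hb1 hp
  obtain ⟨x, hx0, hwx, hxk, e⟩ := exists_tangent_regionC hv₀ hb hb1 h
  obtain ⟨θ, hθ⟩ : ∃ θ, θ = x + v₀ - a := ⟨_, rfl⟩
  have hxθ : x = θ - v₀ + a := by rw [hθ]; ring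
  have hθL : (1 + p.m - p.c) * v₀ < θ := by rw [hθ]; linarith
  have hθK : θ < (1 + p.m) * v₀ := by rw [hθ]; linarith
  have hxb := Real.rpow_pos_of_pos hx0 (-b)
  have ht : IsTangentPoint v₀ a b p (x ^ (-b)) θ := by
    refine ⟨hθL.le, hxb, ?_, ?_⟩
    · rw [utility_zero hv₀ hp, managerUtility, hara, payoff_middle hθL.le hθK.le, ← hxθ, e, hθ]
      ring
    · have e1 := rpow_neg_rpow_neg_inv hb hx0
      rw [demand_of_lower hα hα1 hb hxb (by rw [e1]; exact hxk.le), e1, hθ]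
      ring
  have hs := ht.chordSlope_eq hv₀ hp
  refine ⟨θ, ⟨⟨hθL, hθK⟩, (equationC_iff hb1 hx0 hxθ).2 e⟩, ?_,
    ht.isConcavificationPoint_iff hv₀ hb hb1 hp, by rw [hs, ← hxθ], ?_⟩
  · intro v hv hE
    have hv1 := hv.1
    -- Beyond the flat level, v - v₀ + a exceeds the nonnegative floor.
    have hx' : 0 < v - v₀ + a := by linarith
    have e' := (equationC_iff hb1 hx' rfl).1 hE
    have := tangent_unique hb hb1 hx' hx0 (by linarith) (by linarith) e' e
    linarith
  · rw [hs]
    exact ht.isSolvedBy hZ hv₀ hb hb1 hp fun y z hy hz => valueC_eq hb hp hx0 hxk hy hz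

end Regions

end FirstLoss

theorem mainTheorem3 {Ω : Type*} {mΩ : MeasurableSpace Ω} (Q : Measure Ω)
    [IsProbabilityMeasure Q] (T : ℝ) (hT : 0 < T)
    (ℱ : Filtration (Set.Icc (0 : ℝ) T) mΩ) (W : Set.Icc (0 : ℝ) T → Ω → ℝ)
    (hW : FirstLoss.IsWienerProcess W ℱ Q)
    (r μ σ : ℝ) (hσ : 0 < σ) (hμr : μ ≠ r)
    (v₀ a b : ℝ) (hv₀ : 0 < v₀) (hb : 0 < b) (hb1 : b ≠ 1) :
    -- the three regions partition the set of fee structures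
    (FirstLoss.regionA v₀ a b ∪ FirstLoss.regionB v₀ a b ∪ FirstLoss.regionC v₀ a b
        = FirstLoss.admissibleFees v₀ a b ∧
      Disjoint (FirstLoss.regionA v₀ a b) (FirstLoss.regionB v₀ a b) ∧
      Disjoint (FirstLoss.regionA v₀ a b) (FirstLoss.regionC v₀ a b) ∧
      Disjoint (FirstLoss.regionB v₀ a b) (FirstLoss.regionC v₀ a b)) ∧
    -- Case A
    (∀ p ∈ FirstLoss.regionA v₀ a b, ∃ θ : ℝ,
      (θ ∈ Set.Ioi ((1 + p.m) * v₀) ∧ FirstLoss.EquationA v₀ a b p θ) ∧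
      (∀ v ∈ Set.Ioi ((1 + p.m) * v₀), FirstLoss.EquationA v₀ a b p v → v = θ) ∧
      (∀ v : ℝ, FirstLoss.IsConcavificationPoint v₀ a b p v ↔ v = θ) ∧
      FirstLoss.chordSlope (FirstLoss.managerUtility v₀ a b p) θ
        = p.α * (p.α * θ + (p.m - p.α * (1 + p.m)) * v₀ + a) ^ (-b) ∧
      FirstLoss.IsSolvedBy Q (ℱ (FirstLoss.terminal hT))
        (FirstLoss.statePriceDensity r μ σ W (FirstLoss.terminal hT)) v₀
        (FirstLoss.managerUtility v₀ a b p)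
        (FirstLoss.valueA v₀ a b p
          (FirstLoss.chordSlope (FirstLoss.managerUtility v₀ a b p) θ))) ∧
    -- Case B
    (∀ p ∈ FirstLoss.regionB v₀ a b,
      (∀ v : ℝ, FirstLoss.IsConcavificationPoint v₀ a b p v ↔ v = (1 + p.m) * v₀) ∧
      FirstLoss.chordSlope (FirstLoss.managerUtility v₀ a b p) ((1 + p.m) * v₀)
        = FirstLoss.thresholdH v₀ a b p ∧
      FirstLoss.IsSolvedBy Q (ℱ (FirstLoss.terminal hT))
        (FirstLoss.statePriceDensity r μ σ W (FirstLoss.terminal hT)) v₀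
        (FirstLoss.managerUtility v₀ a b p)
        (FirstLoss.valueB v₀ a b p (FirstLoss.thresholdH v₀ a b p))) ∧
    -- Case C
    (∀ p ∈ FirstLoss.regionC v₀ a b, ∃ θ : ℝ,
      (θ ∈ Set.Ioo ((1 + p.m - p.c) * v₀) ((1 + p.m) * v₀) ∧
        FirstLoss.EquationC v₀ a b p θ) ∧
      (∀ v ∈ Set.Ioo ((1 + p.m - p.c) * v₀) ((1 + p.m) * v₀),
        FirstLoss.EquationC v₀ a b p v → v = θ) ∧
      (∀ v : ℝ, FirstLoss.IsConcavificationPoint v₀ a b p v ↔ v = θ) ∧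
      FirstLoss.chordSlope (FirstLoss.managerUtility v₀ a b p) θ
        = (θ - v₀ + a) ^ (-b) ∧
      FirstLoss.IsSolvedBy Q (ℱ (FirstLoss.terminal hT))
        (FirstLoss.statePriceDensity r μ σ W (FirstLoss.terminal hT)) v₀
        (FirstLoss.managerUtility v₀ a b p)
        (FirstLoss.valueC v₀ a b p
          (FirstLoss.chordSlope (FirstLoss.managerUtility v₀ a b p) θ))) := by
  have hZ := FirstLoss.isRegularPrice_statePriceDensity hT hW (r := r) hσ hμr
  exact ⟨FirstLoss.regions_partition hv₀ hb hb1,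
    fun p hp => FirstLoss.caseA hZ hv₀ hb hb1 hp,
    fun p hp => FirstLoss.caseB hZ hv₀ hb hb1 hp,
    fun p hp => FirstLoss.caseC hZ hv₀ hb hb1 hp⟩
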